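/- Let $T$ be an $n$-vertex tree and let $\ell\ge 0$ be an integer. The $(n-\ell)$-deck of a graph is the multiset of its induced subgraphs with $n-\ell$ vertices, up to isomorphism. A $j$-vine is a tree of diameter $2j$, and a $j$-evine is a tree of diameter $2j+1$. Suppose that there is a largest integer $j$ such that $T$ contains a $j$-evine and every $j$-evine in $T$ has fewer than $n-\ell$ vertices, and let $k$ be this integer. Let $S_{k-1,k-1,k-1}$ be the union of three paths of length $k-1$ that share one endpoint and are otherwise disjoint. Suppose that $T$ contains no copy of it. Then every longest path of $T$ has the same two vertices $x_1,x_2$ at distance $k-1$ from its ends, $x_1\ne x_2$, and each $x_i$ is the center of a maximal $(k-1)$-vine $U_i$ in $T$. Call the edge of $U_i$ at $x_i$ that lies on the $x_1,x_2$-path the trunk edge of $U_i$, and call a component of $U_i-x_i$ that contains a path with $k-1$ vertices beginning at a neighbor of $x_i$ a major piece of $U_i$. Each $U_i$ has exactly two major pieces, and one of them (the inner one) contains the end of the trunk edge other than $x_i$. The deck determines $U_1$ and $U_2$ together with their trunk edges. That is, let $T'$ be any $n$-vertex tree with the same $(n-\ell)$-deck as $T$. Then $k$ is also the corresponding integer for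 $T'$, the tree $T'$ contains no copy of $S_{k-1,k-1,k-1}$, the vines $U_1',U_2'$ with centers $x_1',x_2'$ and their trunk edges exist in $T'$ in the same sense, and there is a permutation $\sigma$ of $\{1,2\}$ such that for each $i\in\{1,2\}$ there is a graph isomorphism from $U_i$ to $U'_{\sigma(i)}$ that maps $x_i$ to $x'_{\sigma(i)}$, the trunk edge of $U_i$ to the trunk edge of $U'_{\sigma(i)}$, and the inner major piece of $U_i$ to the inner major piece of $U'_{\sigma(i)}$. -/

import Mathlib

/-- The `m`-deck of a finite graph `G`: the multiset of its `m`-vertex induced subgraphs, taken up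
to isomorphism, given by its multiplicity function.  To a graph `F` on `m` vertices it assigns the
number of `m`-sets of vertices of `G` that induce a copy of `F`. -/
noncomputable def deck {V : Type*} (G : SimpleGraph V) (m : ℕ) (F : SimpleGraph (Fin m)) : ℕ :=
  {S : Set V | Nonempty (G.induce S ≃g F)}.ncard

/-- `S` is the vertex set of a `j`-vine in `G`: a tree of diameter `2j`. -/
def IsVine {V : Type*} (G : SimpleGraph V) (j : ℕ) (S : Set V) : Prop :=
  (G.induce S).IsTree ∧ (G.induce S).diam = 2 * j

/-- `S` is the vertex set of a `j`-evine in `G`: a tree of diameter `2j+1`. -/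
def IsEvine {V : Type*} (G : SimpleGraph V) (j : ℕ) (S : Set V) : Prop :=
  (G.induce S).IsTree ∧ (G.induce S).diam = 2 * j + 1

/-- `k` is the largest integer `j` such that the `n`-vertex graph `G` contains a `j`-evine and every
`j`-evine in `G` has fewer than `n - ℓ` vertices. -/
def IsVineLevel {V : Type*} (G : SimpleGraph V) (ℓ k : ℕ) : Prop :=
  IsGreatest {j : ℕ | (∃ S, IsEvine G j S) ∧ ∀ S, IsEvine G j S → S.ncard < Nat.card V - ℓ} k

/-- The spider whose legs have lengths `j 0, …, j (d - 1)`.  The vertex `none` is the common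
endpoint of the legs; `some ⟨i, a⟩` is the vertex of leg `i` at distance `a + 1` from it. -/
def spider {d : ℕ} (j : Fin d → ℕ) : SimpleGraph (Option (Σ i : Fin d, Fin (j i))) :=
  SimpleGraph.fromRel fun u v =>
    match u, v with
    | none, some q => (q.2 : ℕ) = 0
    | some p, some q => p.1 = q.1 ∧ (q.2 : ℕ) = (p.2 : ℕ) + 1
    | _, none => False

/-- `G` contains a copy of the spider with three legs of length `j`. -/
def ContainsThreeSpider {V : Type*} (G : SimpleGraph V) (j : ℕ) : Prop :=
  SimpleGraph.IsContained (spider fun _ : Fin 3 => j) G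

/-- `p` is a longest path of `G`. -/
def IsLongestPath {V : Type*} (G : SimpleGraph V) {a b : V} (p : G.Walk a b) : Prop :=
  p.IsPath ∧ ∀ (c d : V) (q : G.Walk c d), q.IsPath → q.length ≤ p.length

/-- The vertex sets of the major pieces of the `j`-vine `U` with center `x`: the components of
`U - x` that contain a path with `j` vertices beginning at a neighbor of `x`. -/
def majorPieces {V : Type*} (G : SimpleGraph V) (j : ℕ) (U : Set V) (x : V) : Set (Set V) :=
  {M | ∃ v : ↥(U \ {x}), G.Adj x v ∧
    (∃ (w : ↥(U \ {x})) (p : (G.induce (U \ {x})).Walk v w), p.IsPath ∧ p.support.length = j) ∧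
    M = Subtype.val '' {w : ↥(U \ {x}) | (G.induce (U \ {x})).Reachable v w}}

/-- `U 0` and `U 1` are the two maximal `(k-1)`-vines of `G` at the ends of the longest paths,
`x i` is the center of `U i`, and the edge joining `x i` and `t i` is the trunk edge of `U i`. -/
structure IsEndVines {V : Type*} (G : SimpleGraph V) (k : ℕ) (U : Fin 2 → Set V)
    (x t : Fin 2 → V) : Prop where
  /-- Each `U i` is a maximal `(k-1)`-vine. -/
  maximal : ∀ i, Maximal (IsVine G (k - 1)) (U i)
  /-- The vertex `x i` is the center of `U i`. -/
  center : ∀ i, ∃ h : x i ∈ U i, (⟨x i, h⟩ : ↥(U i)) ∈ (G.induce (U i)).center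
  /-- The centers are two different vertices. -/
  ne : x 0 ≠ x 1
  /-- The centers are the vertices at distance `k-1` from the two ends of every longest path. -/
  ends : ∀ (a b : V) (p : G.Walk a b), IsLongestPath G p →
    (x 0 = p.getVert (k - 1) ∧ x 1 = p.reverse.getVert (k - 1)) ∨
    (x 1 = p.getVert (k - 1) ∧ x 0 = p.reverse.getVert (k - 1))
  /-- The trunk edge of `U i` is an edge of `U i` at `x i` on the path to the other center. -/
  trunk : ∀ i, t i ∈ U i ∧ ∃ q : G.Walk (x i) (x i.rev), q.IsPath ∧ s(x i, t i) ∈ q.edges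

/-! Put `m = n - ℓ` and `j = k - 1`. A subtree of diameter at most `2k+1` extends to a `k`-evine, so
it has fewer than `m` vertices. Double counting pairs (copy, `m`-set containing it) shows that the
deck gives the number of copies of every graph with at most `m` vertices. This already transfers `k`
and the absence of the spider: an evine of `T'` with at least `m` vertices could be pruned to
exactly `m` vertices and would then occur in `T`.

A subtree of diameter `d` lies in exactly one maximal one. The copies of a fixed tree of diameter
`d` can therefore be sorted by the maximal subtrees that contain them. Subtracting the contributions
of the larger maximal subtrees, by descending induction on size, determines the multiset of maximal
subtrees for each `d ≤ 2k+1` (`IsTree.exists_equiv_maximal`).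

A maximal `j`-vine is the ball of radius `j` around its center, and a maximal `j`-evine is the union
of two such balls around the ends of its central edge. Without the spider, the vine centers are
exactly the vertices of a longest path at distance at least `j` from both its ends, and paths of
length `j` from a center must start along that path. Hence exactly two directed edges lead in such a
major direction from a center to a non-center: they start at `x_1` and `x_2` and point away from the
trunk.

These outward edges are detected by subtraction. Fix the isomorphism type of a ball with its center
and a neighbor marked. The maximal `j`-vines count all directed edges of this type, and the maximal
`j`-evines count those whose second end is also a center; the difference counts the rest. So each
outward type of `T` occurs in `T'` and conversely (`IsTree.exists_isOutward`), which yields the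
permutation. Since an end center has only two major directions, an isomorphism that respects the
outward edge also respects the trunk edge. -/

namespace SimpleGraph

/-! ### Betweenness and medians in trees -/

section TreeMetric

variable {V : Type*} {T : SimpleGraph V}

lemma IsTree.length_eq_dist (hT : T.IsTree) {a b : V} {p : T.Walk a b} (hp : p.IsPath) :
    p.length = T.dist a b := by
  obtain ⟨q, hq, hl⟩ := hT.connected.exists_path_of_dist a b
  have : p = q := congrArg Subtype.val ((hT.isAcyclic.subsingleton_path a b).elim ⟨p, hp⟩ ⟨q, hq⟩)
  rw [this, hl]

/-- Geodesics from `a` to `c` and from `c` to `b` concatenate to a path, which by uniqueness is what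
any walk from `a` to `b` reduces to. -/
lemma IsTree.mem_support_of_dist (hT : T.IsTree) {a b c : V}
    (h : T.dist a c + T.dist c b = T.dist a b) (p : T.Walk a b) : c ∈ p.support := by
  classical
  obtain ⟨q, hq⟩ := hT.connected.exists_walk_length_eq_dist a c
  obtain ⟨r, hr⟩ := hT.connected.exists_walk_length_eq_dist c b
  have hqr : (q.append r).IsPath :=
    Walk.isPath_of_length_eq_dist _ (by rw [Walk.length_append, hq, hr, h])
  have : p.bypass = q.append r :=
    congrArg Subtype.val
      ((hT.isAcyclic.subsingleton_path a b).elim ⟨_, p.bypass_isPath⟩ ⟨_, hqr⟩)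
  apply p.support_bypass_subset_support
  rw [this, Walk.mem_support_append_iff]
  exact Or.inl q.end_mem_support

lemma IsTree.dist_of_mem_support (hT : T.IsTree) {a b c : V} {p : T.Walk a b} (hp : p.IsPath)
    (hc : c ∈ p.support) : T.dist a c + T.dist c b = T.dist a b := by
  classical
  rw [← hT.length_eq_dist hp, ← hT.length_eq_dist (hp.takeUntil hc),
    ← hT.length_eq_dist (hp.dropUntil hc), ← Walk.length_append, Walk.take_spec]

/-- A detour from `a` to `b` through `s` must pass the separating vertex `c`. This dichotomy,
combined with linear arithmetic, replaces most arguments about paths below. -/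
lemma IsTree.dist_or (hT : T.IsTree) {a b c : V} (h : T.dist a c + T.dist c b = T.dist a b)
    (s : V) : T.dist a c + T.dist c s = T.dist a s ∨ T.dist s c + T.dist c b = T.dist s b := by
  obtain ⟨p, hp, -⟩ := hT.connected.exists_path_of_dist a s
  obtain ⟨q, hq, -⟩ := hT.connected.exists_path_of_dist s b
  have := hT.mem_support_of_dist h (p.append q)
  rw [Walk.mem_support_append_iff] at this
  exact this.imp (hT.dist_of_mem_support hp) (hT.dist_of_mem_support hq)

lemma IsTree.exists_dist_eq (hT : T.IsTree) {a b : V} {i : ℕ} (hi : i ≤ T.dist a b) :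
    ∃ c, T.dist a c = i ∧ T.dist c b = T.dist a b - i := by
  obtain ⟨p, hp⟩ := hT.connected.exists_walk_length_eq_dist a b
  have h1 : T.dist a (p.getVert i) ≤ i := (dist_le (p.take i)).trans (by simp)
  have h2 : T.dist (p.getVert i) b ≤ T.dist a b - i := (dist_le (p.drop i)).trans (by simp [hp])
  have h3 := hT.connected.dist_triangle (u := a) (v := p.getVert i) (w := b)
  exact ⟨p.getVert i, by omega, by omega⟩

lemma IsTree.eq_of_dist_eq (hT : T.IsTree) {a b c c' : V}
    (h : T.dist a c + T.dist c b = T.dist a b) (h' : T.dist a c' + T.dist c' b = T.dist a b)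
    (hc : T.dist a c = T.dist a c') : c = c' := by
  rw [← hT.connected.dist_eq_zero_iff]
  have := T.dist_comm (u := c) (v := c')
  rcases hT.dist_or h c' with h1 | h1 <;> omega

/-- Three vertices of a tree have a median. -/
lemma IsTree.exists_median (hT : T.IsTree) (a b v : V) :
    ∃ c, T.dist a c + T.dist c b = T.dist a b ∧ T.dist a c + T.dist c v = T.dist a v ∧
      T.dist v c + T.dist c b = T.dist v b := by
  let P : ℕ → Prop := fun i => ∃ c, T.dist a c = i ∧ T.dist a c + T.dist c b = T.dist a b ∧
    T.dist a c + T.dist c v = T.dist a v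
  classical
  -- The median is the last vertex on the way from `a` to `b` that is also on the way from `a` to
  -- `v`. The next vertex towards `b` violates `P`, which places it between `v` and `b`.
  obtain ⟨c, hc, hcb, hcv⟩ : P (Nat.findGreatest P (T.dist a b)) :=
    Nat.findGreatest_spec (P := P) (Nat.zero_le _) ⟨a, by simp⟩
  refine ⟨c, hcb, hcv, ?_⟩
  by_cases h0 : c = b
  · subst h0; simp
  have hpos : 1 ≤ T.dist c b := hT.connected.pos_dist_of_ne h0
  obtain ⟨c', h1, h2⟩ := hT.exists_dist_eq hpos
  have t1 := hT.connected.dist_triangle (u := a) (v := c) (w := c')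
  have t2 := hT.connected.dist_triangle (u := a) (v := c') (w := b)
  have hc'b : T.dist a c' + T.dist c' b = T.dist a b := by omega
  have hnot : ¬ (T.dist a c' + T.dist c' v = T.dist a v) := fun h => by
    have := Nat.le_findGreatest (P := P) (n := T.dist a b) (m := T.dist a c') (by omega)
      ⟨c', rfl, hc'b, h⟩
    omega
  have hb := (hT.dist_or hc'b v).resolve_left hnot
  have hadj : T.Adj c c' := dist_eq_one_iff_adj.mp h1
  have h3 := hT.dist_eq_dist_add_one_of_adj v hadj
  have e1 := T.dist_comm (u := c) (v := v)
  have e2 := T.dist_comm (u := c') (v := v)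
  omega

lemma IsTree.four_point (hT : T.IsTree) (a b v w : V) :
    T.dist v w + T.dist a b ≤ T.dist a v + T.dist w b ∨
      T.dist v w + T.dist a b ≤ T.dist v b + T.dist a w := by
  obtain ⟨c, h1, h2, h3⟩ := hT.exists_median a b v
  have := hT.connected.dist_triangle (u := v) (v := c) (w := w)
  have e1 := T.dist_comm (u := c) (v := v)
  have e2 := T.dist_comm (u := c) (v := w)
  rcases hT.dist_or h1 w with h | h <;> omega

/-- Distance from a fixed vertex is quasi-convex in a tree. -/
lemma IsTree.dist_le_of_between (hT : T.IsTree) {a b c s : V} {r : ℕ}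
    (h : T.dist a c + T.dist c b = T.dist a b) (ha : T.dist s a ≤ r) (hb : T.dist s b ≤ r) :
    T.dist s c ≤ r := by
  have e1 := T.dist_comm (u := c) (v := s)
  have e2 := T.dist_comm (u := a) (v := s)
  rcases hT.dist_or h s with h | h <;> omega

/-- `S` is a geodesically convex vertex set of diameter `d`. In a tree, these are the vertex sets
of the subtrees of diameter `d`. -/
structure IsSubtree (T : SimpleGraph V) (d : ℕ) (S : Set V) : Prop where
  convex : ∀ a ∈ S, ∀ b ∈ S, ∀ c, T.dist a c + T.dist c b = T.dist a b → c ∈ S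
  le : ∀ a ∈ S, ∀ b ∈ S, T.dist a b ≤ d
  exists_eq : ∃ a ∈ S, ∃ b ∈ S, T.dist a b = d

lemma IsTree.exists_walk_induce (hT : T.IsTree) {S : Set V}
    (hS : ∀ a ∈ S, ∀ b ∈ S, ∀ c, T.dist a c + T.dist c b = T.dist a b → c ∈ S) (a b : S) :
    ∃ p : (T.induce S).Walk a b, p.length = T.dist (a : V) b := by
  obtain ⟨p, hp, hl⟩ := hT.connected.exists_path_of_dist (a : V) b
  have hsup : ∀ x ∈ p.support, x ∈ S := fun x hx =>
    hS a a.2 b b.2 x (hT.dist_of_mem_support hp hx)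
  refine ⟨p.induce S hsup, ?_⟩
  rw [← hl, ← Walk.length_map (Embedding.induce S).toHom, Walk.map_induce]
  rfl

lemma dist_le_dist_induce {S : Set V} {a b : S} (h : (T.induce S).Reachable a b) :
    T.dist (a : V) b ≤ (T.induce S).dist a b := by
  obtain ⟨p, hp⟩ := h.exists_walk_length_eq_dist
  rw [← hp, ← Walk.length_map (Embedding.induce S).toHom]
  exact dist_le (p.map (Embedding.induce S).toHom)

lemma IsTree.dist_induce (hT : T.IsTree) {S : Set V}
    (hS : ∀ a ∈ S, ∀ b ∈ S, ∀ c, T.dist a c + T.dist c b = T.dist a b → c ∈ S) (a b : S) :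
    (T.induce S).dist a b = T.dist (a : V) b := by
  obtain ⟨p, hp⟩ := hT.exists_walk_induce hS a b
  exact le_antisymm (hp ▸ dist_le p) (dist_le_dist_induce p.reachable)

/-- Acyclicity is inherited, so only connectedness matters, and the unique paths of `T` must then
stay inside `S`. -/
lemma IsTree.isTree_induce_iff (hT : T.IsTree) {S : Set V} :
    (T.induce S).IsTree ↔ S.Nonempty ∧
      ∀ a ∈ S, ∀ b ∈ S, ∀ c, T.dist a c + T.dist c b = T.dist a b → c ∈ S := by
  constructor
  · intro h
    obtain ⟨x⟩ := h.connected.nonempty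
    refine ⟨⟨x, x.2⟩, fun a ha b hb c hc => ?_⟩
    obtain ⟨p, -⟩ := h.connected.exists_walk_length_eq_dist ⟨a, ha⟩ ⟨b, hb⟩
    have := hT.mem_support_of_dist (a := (Embedding.induce S).toHom ⟨a, ha⟩)
      (b := (Embedding.induce S).toHom ⟨b, hb⟩) hc (p.map (Embedding.induce S).toHom)
    rw [Walk.support_map, List.mem_map] at this
    obtain ⟨y, -, hy⟩ := this
    exact hy ▸ y.2
  · rintro ⟨hne, h⟩
    have := hne.to_subtype
    exact ⟨⟨fun a b => (hT.exists_walk_induce h a b).choose.reachable⟩, hT.isAcyclic.induce S⟩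

lemma IsTree.isSubtree_iff [Finite V] (hT : T.IsTree) {S : Set V} {d : ℕ} :
    ((T.induce S).IsTree ∧ (T.induce S).diam = d) ↔ T.IsSubtree d S := by
  constructor
  · rintro ⟨h, rfl⟩
    obtain ⟨hne, hconv⟩ := hT.isTree_induce_iff.mp h
    have := hne.to_subtype
    refine ⟨hconv, fun a ha b hb => ?_, ?_⟩
    · rw [← hT.dist_induce hconv ⟨a, ha⟩ ⟨b, hb⟩]
      exact dist_le_diam (connected_iff_ediam_ne_top.mp h.connected)
    · obtain ⟨a, b, hab⟩ := (T.induce S).exists_dist_eq_diam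
      exact ⟨a, a.2, b, b.2, by rw [← hT.dist_induce hconv, hab]⟩
  · intro h
    obtain ⟨a, ha, b, hb, hab⟩ := h.exists_eq
    have ht : (T.induce S).IsTree := hT.isTree_induce_iff.mpr ⟨⟨a, ha⟩, h.convex⟩
    have : Nonempty S := ⟨⟨a, ha⟩⟩
    refine ⟨ht, le_antisymm ?_ ?_⟩
    · obtain ⟨a, b, hab⟩ := (T.induce S).exists_dist_eq_diam
      rw [← hab, hT.dist_induce h.convex]
      exact h.le a a.2 b b.2
    · rw [← hab, ← hT.dist_induce h.convex ⟨a, ha⟩ ⟨b, hb⟩]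
      exact dist_le_diam (connected_iff_ediam_ne_top.mp ht.connected)

end TreeMetric

end SimpleGraph

namespace SimpleGraph

/-! ### Extending and pruning subtrees of given diameter -/

section Subtrees

variable {V : Type*} {T : SimpleGraph V}

/-- Every subtree of diameter `d` lies in a greatest one. -/
lemma IsTree.exists_greatest_isSubtree (hT : T.IsTree) {d : ℕ} {S : Set V}
    (hS : T.IsSubtree d S) :
    ∃ W, T.IsSubtree d W ∧ S ⊆ W ∧ ∀ M, T.IsSubtree d M → S ⊆ M → M ⊆ W := by
  obtain ⟨a, ha, b, hb, hab⟩ := hS.exists_eq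
  have key : ∀ M, T.IsSubtree d M → S ⊆ M → M ⊆ {v | T.dist a v ≤ d ∧ T.dist v b ≤ d} :=
    fun M hM hSM v hv => ⟨hM.le a (hSM ha) v hv, hM.le v hv b (hSM hb)⟩
  -- One diametral pair already determines the greatest subtree; the four-point condition bounds its
  -- diameter by `d`.
  refine ⟨{v | T.dist a v ≤ d ∧ T.dist v b ≤ d}, ⟨?_, ?_, ?_⟩, key S hS subset_rfl, key⟩
  · rintro u ⟨hu, hu'⟩ v ⟨hv, hv'⟩ c hc
    rw [dist_comm] at hu' hv'
    exact ⟨hT.dist_le_of_between hc hu hv, dist_comm (G := T) ▸ hT.dist_le_of_between hc hu' hv'⟩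
  · rintro u ⟨hu, hu'⟩ v ⟨hv, hv'⟩
    rcases hT.four_point a b u v with h | h <;> omega
  · exact ⟨a, key S hS subset_rfl ha, b, key S hS subset_rfl hb, hab⟩

/-- Geodesic convexity of a vertex set. -/
def GeodConvex (T : SimpleGraph V) (S : Set V) : Prop :=
  ∀ a ∈ S, ∀ b ∈ S, ∀ c, T.dist a c + T.dist c b = T.dist a b → c ∈ S

lemma IsTree.exists_adj_of_ssubset (hT : T.IsTree) {S W : Set V} (hne : S.Nonempty)
    (hW : T.GeodConvex W) (h : S ⊂ W) : ∃ s ∈ S, ∃ c ∈ W, c ∉ S ∧ T.Adj s c := by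
  obtain ⟨s, hs⟩ := hne
  obtain ⟨w, hw, hwS⟩ := Set.exists_of_ssubset h
  induction hn : T.dist s w generalizing s with
  | zero =>
    rw [hT.connected.dist_eq_zero_iff] at hn
    exact absurd (hn ▸ hs) hwS
  | succ n ih =>
    obtain ⟨c, h1, h2⟩ := hT.exists_dist_eq (a := s) (b := w) (i := 1) (by omega)
    by_cases hc : c ∈ S
    · exact ih c hc (by omega)
    · exact ⟨s, hs, c, hW s (h.1 hs) w hw c (by omega), hc, dist_eq_one_iff_adj.mp h1⟩

/-- Otherwise `c` would lie between `s` and `b`, hence in `S`. -/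
lemma GeodConvex.dist_eq_of_adj (hT : T.IsTree) {S : Set V} (hS : T.GeodConvex S) {s c : V}
    (hs : s ∈ S) (hc : c ∉ S) (h : T.Adj s c) {b : V} (hb : b ∈ S) :
    T.dist c b = T.dist s b + 1 := by
  have h1 : T.dist s c = 1 := dist_eq_one_iff_adj.mpr h
  have h2 := hT.dist_eq_dist_add_one_of_adj b h
  have e1 := T.dist_comm (u := b) (v := s)
  have e2 := T.dist_comm (u := b) (v := c)
  by_contra hne
  exact hc (hS s hs b hb c (by omega))

lemma GeodConvex.insert (hT : T.IsTree) {S : Set V} (hS : T.GeodConvex S) {s c : V}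
    (hs : s ∈ S) (hc : c ∉ S) (h : T.Adj s c) : T.GeodConvex (Insert.insert c S) := by
  have key : ∀ b ∈ S, ∀ x, T.dist c x + T.dist x b = T.dist c b → x ∈ Insert.insert c S := by
    intro b hb x hx
    have h1 : T.dist c s = 1 := dist_eq_one_iff_adj.mpr h.symm
    have h2 := hS.dist_eq_of_adj hT hs hc h hb
    have e := T.dist_comm (u := x) (v := s)
    by_cases h0 : T.dist c x = 0
    · exact Or.inl ((hT.connected.dist_eq_zero_iff.mp h0).symm)
    right
    rcases hT.dist_or (a := c) (b := b) (c := s) (by omega) x with h3 | h3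
    · exact hS s hs b hb x (by omega)
    · have : T.dist x s = 0 := by omega
      rw [hT.connected.dist_eq_zero_iff.mp this]
      exact hs
  rintro a (rfl | ha) b (rfl | hb) x hx
  · rw [dist_self] at hx
    exact Or.inl ((hT.connected.dist_eq_zero_iff.mp (by omega : T.dist _ x = 0)).symm)
  · exact key b hb x hx
  · exact key a ha x (by
      rw [T.dist_comm (u := b) (v := x), T.dist_comm (u := x) (v := a),
        T.dist_comm (u := b) (v := a)]; omega)
  · exact Or.inr (hS a ha b hb x hx)

/-- A subtree of diameter at most `e` extends to one of diameter exactly `e`, if the tree has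
diameter at least `e`. -/
lemma IsTree.exists_isSubtree_of_le [Finite V] (hT : T.IsTree) {e : ℕ} {S : Set V}
    (hS : T.GeodConvex S) (hne : S.Nonempty) (hle : ∀ a ∈ S, ∀ b ∈ S, T.dist a b ≤ e)
    (he : ∃ a b, e ≤ T.dist a b) : ∃ W, S ⊆ W ∧ T.IsSubtree e W := by
  obtain ⟨W, hSW, hW⟩ := (Set.toFinite {W : Set V | T.GeodConvex W ∧
    ∀ a ∈ W, ∀ b ∈ W, T.dist a b ≤ e}).exists_le_maximal ⟨hS, hle⟩
  refine ⟨W, hSW, hW.prop.1, hW.prop.2, ?_⟩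
  by_contra! hno
  have hlt : ∀ a ∈ W, ∀ b ∈ W, T.dist a b < e :=
    fun a ha b hb => lt_of_le_of_ne (hW.prop.2 a ha b hb) (hno a ha b hb)
  have hss : W ⊂ Set.univ := by
    refine Set.ssubset_univ_iff.mpr fun h => ?_
    obtain ⟨a, b, hab⟩ := he
    have := hlt a (h ▸ trivial) b (h ▸ trivial)
    omega
  obtain ⟨s, hs, c, -, hc, hadj⟩ := hT.exists_adj_of_ssubset (hne.mono hSW)
    (fun _ _ _ _ _ _ => trivial) hss
  -- If no distance in `W` equals `e`, then adding a neighbor, which lies one further from each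
  -- vertex of `W` than `s` does, still keeps the diameter at most `e`.
  refine hc (hW.le_of_ge (y := insert c W) ⟨hW.prop.1.insert hT hs hc hadj, ?_⟩
    (Set.subset_insert c W) (Set.mem_insert c W))
  rintro a (rfl | ha) b (rfl | hb)
  · simp
  · rw [hW.prop.1.dist_eq_of_adj hT hs hc hadj hb]
    exact hlt s hs b hb
  · rw [dist_comm, hW.prop.1.dist_eq_of_adj hT hs hc hadj ha]
    exact hlt s hs a ha
  · exact hW.prop.2 a ha b hb

lemma IsTree.exists_geodConvex_ncard_eq [Finite V] (hT : T.IsTree) {m : ℕ} {S W : Set V}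
    (hS : T.GeodConvex S) (hne : S.Nonempty) (hW : T.GeodConvex W) (hSW : S ⊆ W)
    (hm : S.ncard ≤ m) (hm' : m ≤ W.ncard) :
    ∃ M, S ⊆ M ∧ M ⊆ W ∧ T.GeodConvex M ∧ M.ncard = m := by
  obtain ⟨M, hSM, hM⟩ := (Set.toFinite {M : Set V | T.GeodConvex M ∧ M ⊆ W ∧
    M.ncard ≤ m}).exists_le_maximal ⟨hS, hSW, hm⟩
  refine ⟨M, hSM, hM.prop.2.1, hM.prop.1, le_antisymm hM.prop.2.2 ?_⟩
  by_contra! hlt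
  have hss : M ⊂ W := hM.prop.2.1.ssubset_of_ne (by rintro rfl; omega)
  obtain ⟨s, hs, c, hcW, hc, hadj⟩ := hT.exists_adj_of_ssubset (hne.mono hSM) hW hss
  exact hc (hM.le_of_ge (y := insert c M) ⟨hM.prop.1.insert hT hs hc hadj,
    Set.insert_subset hcW hM.prop.2.1, by rw [Set.ncard_insert_of_notMem hc]; omega⟩
    (Set.subset_insert c M) (Set.mem_insert c M))

lemma IsTree.geodConvex_interval (hT : T.IsTree) (a b : V) :
    T.GeodConvex {c | T.dist a c + T.dist c b = T.dist a b} := by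
  intro x hx y hy z hz
  simp only [Set.mem_ofPred_eq] at hx hy ⊢
  have := hT.connected.dist_triangle (u := a) (v := z) (w := b)
  have e1 := T.dist_comm (u := x) (v := y)
  have e2 := T.dist_comm (u := x) (v := z)
  have e3 := T.dist_comm (u := y) (v := z)
  have e4 := T.dist_comm (u := x) (v := a)
  have e5 := T.dist_comm (u := y) (v := a)
  have e6 := T.dist_comm (u := z) (v := a)
  have e7 := T.dist_comm (u := b) (v := x)
  have e8 := T.dist_comm (u := b) (v := y)
  have e9 := T.dist_comm (u := b) (v := z)
  rcases hT.dist_or hz a with h1 | h1 <;> rcases hT.dist_or hz b with h2 | h2 <;>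
    rcases hT.dist_or hx y with h3 | h3 <;> omega

lemma IsTree.ncard_interval_le (hT : T.IsTree) (a b : V) :
    {c | T.dist a c + T.dist c b = T.dist a b}.ncard ≤ T.dist a b + 1 := by
  have hinj : Set.InjOn (T.dist a) {c | T.dist a c + T.dist c b = T.dist a b} :=
    fun x hx y hy h => hT.eq_of_dist_eq hx hy h
  rw [← hinj.ncard_image]
  refine (Set.ncard_le_ncard (t := ↑(Finset.range (T.dist a b + 1))) ?_
    (Finset.finite_toSet _)).trans (by simp)
  rintro _ ⟨x, hx, rfl⟩
  simp only [Set.mem_ofPred_eq] at hx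
  simp only [Finset.coe_range, Set.mem_Iio]
  omega

lemma IsTree.lt_ncard [Finite V] (hT : T.IsTree) {d : ℕ} {S : Set V} (hS : T.IsSubtree d S) :
    d < S.ncard := by
  obtain ⟨a, ha, b, hb, hab⟩ := hS.exists_eq
  have : (↑(Finset.range (d + 1)) : Set ℕ) ⊆ T.dist a '' S := by
    intro i hi
    simp only [Finset.coe_range, Set.mem_Iio] at hi
    obtain ⟨c, h1, h2⟩ := hT.exists_dist_eq (a := a) (b := b) (i := i) (by omega)
    exact ⟨c, hS.convex a ha b hb c (by omega), h1⟩
  have h := (Set.ncard_le_ncard this (Set.toFinite _)).trans (Set.ncard_image_le (Set.toFinite S))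
  rw [Set.ncard_coe_finset, Finset.card_range] at h
  omega

/-- A large subtree of diameter `d` contains such subtrees of all smaller sizes. -/
lemma IsTree.exists_isSubtree_ncard_eq [Finite V] (hT : T.IsTree) {d m : ℕ} {W : Set V}
    (hW : T.IsSubtree d W) (hm : d < m) (hm' : m ≤ W.ncard) :
    ∃ M, T.IsSubtree d M ∧ M.ncard = m := by
  obtain ⟨a, ha, b, hb, hab⟩ := hW.exists_eq
  have ha' : a ∈ {c | T.dist a c + T.dist c b = T.dist a b} := by simp
  have hb' : b ∈ {c | T.dist a c + T.dist c b = T.dist a b} := by simp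
  obtain ⟨M, h1, h2, h3, h4⟩ := hT.exists_geodConvex_ncard_eq (m := m)
    (hT.geodConvex_interval a b) ⟨a, ha'⟩ hW.convex (fun c hc => hW.convex a ha b hb c hc)
    ((hT.ncard_interval_le a b).trans (by omega)) hm'
  exact ⟨M, ⟨h3, fun x hx y hy => hW.le x (h2 hx) y (h2 hy), a, h1 ha', b, h1 hb', hab⟩, h4⟩

end Subtrees

end SimpleGraph

namespace SimpleGraph

/-! ### Counting induced copies from the deck -/

section IsoClasses

variable {V V' : Type*} {G : SimpleGraph V} {G' : SimpleGraph V'}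

/-- Isomorphism of finite graphs, as an equivalence relation. -/
def finIsoSetoid : Setoid (Σ n, SimpleGraph (Fin n)) where
  r A B := Nonempty (A.2 ≃g B.2)
  iseqv := ⟨fun _ => ⟨Iso.refl⟩, fun ⟨e⟩ => ⟨e.symm⟩, fun ⟨e⟩ ⟨f⟩ => ⟨e.trans f⟩⟩

/-- The isomorphism class of a finite graph. -/
noncomputable def isoClass [Finite V] (G : SimpleGraph V) : Quotient finIsoSetoid :=
  Quotient.mk _ ⟨Nat.card V, G.map (Finite.equivFin V).toEmbedding⟩

lemma isoClass_eq_mk_iff [Finite V] {m : ℕ} {F : SimpleGraph (Fin m)} :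
    isoClass G = Quotient.mk finIsoSetoid ⟨m, F⟩ ↔ Nonempty (G ≃g F) := by
  rw [isoClass, Quotient.eq]
  exact ⟨fun ⟨e⟩ => ⟨(Iso.map (Finite.equivFin V) G).trans e⟩,
    fun ⟨e⟩ => ⟨(Iso.map (Finite.equivFin V) G).symm.trans e⟩⟩

lemma isoClass_eq_iff [Finite V] [Finite V'] :
    isoClass G = isoClass G' ↔ Nonempty (G ≃g G') := by
  conv_lhs => rhs; rw [isoClass]
  rw [isoClass_eq_mk_iff]
  exact ⟨fun ⟨e⟩ => ⟨e.trans (Iso.map (Finite.equivFin V') G').symm⟩,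
    fun ⟨e⟩ => ⟨e.trans (Iso.map (Finite.equivFin V') G')⟩⟩

lemma ncard_eq_of_isoClass_induce_eq_mk [Finite V] {S : Set V} {m : ℕ} {F : SimpleGraph (Fin m)}
    (h : isoClass (G.induce S) = Quotient.mk finIsoSetoid ⟨m, F⟩) : S.ncard = m := by
  obtain ⟨e⟩ := isoClass_eq_mk_iff.mp h
  rw [← Nat.card_coe_set_eq, Nat.card_congr e.toEquiv, Nat.card_fin]

/-- Turns equal counts for every isomorphism class into a bijection that preserves classes. -/
lemma exists_equiv_of_card_fiber_eq {α β γ : Type*} [Finite α] [Finite β] (f : α → γ) (g : β → γ)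
    (h : ∀ c, Nat.card {a // f a = c} = Nat.card {b // g b = c}) :
    ∃ e : α ≃ β, ∀ a, g (e a) = f a := by
  have e : ∀ c, {a // f a = c} ≃ {b // g b = c} := fun c => (Finite.card_eq.mp (h c)).some
  exact ⟨(Equiv.sigmaFiberEquiv f).symm.trans
    ((Equiv.sigmaCongrRight e).trans (Equiv.sigmaFiberEquiv g)), fun a => (e (f a) ⟨a, rfl⟩).2⟩

/-- Restriction of an isomorphism of induced subgraphs to smaller vertex sets. -/
def Iso.restrictInduce {S Q : Set V} {S' Q' : Set V'} (φ : G.induce S ≃g G'.induce S')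
    (hQ : Q ⊆ S) (hQ' : Q' ⊆ S') (h : ∀ s : S, (s : V) ∈ Q ↔ (φ s : V') ∈ Q') :
    G.induce Q ≃g G'.induce Q' where
  toFun q := ⟨φ ⟨q, hQ q.2⟩, (h _).mp q.2⟩
  invFun q := ⟨φ.symm ⟨q, hQ' q.2⟩, (h _).mpr (by simp)⟩
  left_inv q := by simp
  right_inv q := by simp
  map_rel_iff' {a b} := φ.map_rel_iff' (a := ⟨a, hQ a.2⟩) (b := ⟨b, hQ b.2⟩)

lemma card_copies_le_of_iso [Finite V] [Finite V'] {S : Set V} {S' : Set V'}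
    (φ : G.induce S ≃g G'.induce S') (q : Quotient finIsoSetoid) :
    Nat.card {Q : Set V // Q ⊆ S ∧ isoClass (G.induce Q) = q} ≤
      Nat.card {Q : Set V' // Q ⊆ S' ∧ isoClass (G'.induce Q) = q} := by
  let im : Set V → Set V' := fun Q => {y | ∃ h : y ∈ S', (φ.symm ⟨y, h⟩ : V) ∈ Q}
  have him : ∀ Q (s : S), (s : V) ∈ Q ↔ (φ s : V') ∈ im Q := fun Q s =>
    ⟨fun h => ⟨(φ s).2, by simpa using h⟩, fun ⟨h, h'⟩ => by simpa using h'⟩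
  have hsub : ∀ Q, im Q ⊆ S' := fun Q y hy => hy.1
  refine Nat.card_le_card_of_injective (fun Q => ⟨im Q.1, hsub _,
    (isoClass_eq_iff.mpr ⟨φ.restrictInduce Q.2.1 (hsub _) (him Q.1)⟩).symm.trans Q.2.2⟩) ?_
  · rintro ⟨Q, hQ, _⟩ ⟨R, hR, _⟩ h
    have h' : im Q = im R := congrArg Subtype.val h
    refine Subtype.ext (Set.ext fun x => ⟨fun hx => ?_, fun hx => ?_⟩)
    · exact (him R ⟨x, hQ hx⟩).mpr (h' ▸ (him Q ⟨x, hQ hx⟩).mp hx)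
    · exact (him Q ⟨x, hR hx⟩).mpr (h' ▸ (him R ⟨x, hR hx⟩).mp hx)

lemma card_copies_eq_of_iso [Finite V] [Finite V'] {S : Set V} {S' : Set V'}
    (φ : G.induce S ≃g G'.induce S') (q : Quotient finIsoSetoid) :
    Nat.card {Q : Set V // Q ⊆ S ∧ isoClass (G.induce Q) = q} =
      Nat.card {Q : Set V' // Q ⊆ S' ∧ isoClass (G'.induce Q) = q} :=
  le_antisymm (card_copies_le_of_iso φ q) (card_copies_le_of_iso φ.symm q)

/-- The value is a binomial coefficient, but only its independence of `Q` matters, so a bijection of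
the ground sets is enough. -/
lemma card_supersets_eq [Finite V] [Finite V'] (hV : Nat.card V = Nat.card V') {Q : Set V}
    {Q' : Set V'} (h : Q.ncard = Q'.ncard) (m : ℕ) :
    Nat.card {S : Set V // S.ncard = m ∧ Q ⊆ S} = Nat.card {S : Set V' // S.ncard = m ∧ Q' ⊆ S} := by
  classical
  have hc : Qᶜ.ncard = Q'ᶜ.ncard := by
    have h1 := Set.ncard_add_ncard_compl Q
    have h2 := Set.ncard_add_ncard_compl Q'
    omega
  obtain ⟨e1⟩ : Nonempty (Q ≃ Q') :=
    Finite.card_eq.mp (by rwa [Nat.card_coe_set_eq, Nat.card_coe_set_eq])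
  obtain ⟨e2⟩ : Nonempty ((Qᶜ : Set V) ≃ (Q'ᶜ : Set V')) :=
    Finite.card_eq.mp (by rwa [Nat.card_coe_set_eq, Nat.card_coe_set_eq])
  let e : V ≃ V' := (Equiv.Set.sumCompl Q).symm.trans
    ((Equiv.sumCongr e1 e2).trans (Equiv.Set.sumCompl Q'))
  have he : e '' Q = Q' := by
    have hsub : e '' Q ⊆ Q' := by
      rintro _ ⟨x, hx, rfl⟩
      simp only [e, Equiv.trans_apply, Equiv.Set.sumCompl_symm_apply_of_mem hx]
      simp
    exact Set.eq_of_subset_of_ncard_le hsub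
      (by rw [Set.ncard_image_of_injective _ e.injective, h]) (Set.toFinite _)
  refine Nat.card_congr ((Equiv.Set.congr e).subtypeEquiv fun S => ?_)
  rw [Equiv.Set.congr_apply, Set.ncard_image_of_injective _ e.injective, ← he,
    Set.image_subset_image_iff e.injective]

lemma card_fiber_eq_deck [Finite V] (r : ℕ) (R : SimpleGraph (Fin r)) :
    Nat.card {S : {S : Set V // S.ncard = r} //
      isoClass (G.induce S.1) = Quotient.mk finIsoSetoid ⟨r, R⟩} = deck G r R := by
  rw [deck, ← Nat.card_coe_set_eq]
  exact Nat.card_congr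
    { toFun := fun S => ⟨S.1.1, isoClass_eq_mk_iff.mp S.2⟩
      invFun := fun S => ⟨⟨S.1, ncard_eq_of_isoClass_induce_eq_mk
        (isoClass_eq_mk_iff.mpr S.2)⟩, isoClass_eq_mk_iff.mpr S.2⟩
      left_inv := fun _ => rfl
      right_inv := fun _ => rfl }

/-- Double counting of pairs (copy, `m`-set containing it). The reference set `Q₀` lives in a
neutral type `W`, so that the same second factor serves both graphs. -/
lemma card_sigma_copies [Finite V] {W : Type*} [Finite W] (hW : Nat.card W = Nat.card V)
    {Q₀ : Set W} {f m : ℕ} (hQ₀ : Q₀.ncard = f) (F : SimpleGraph (Fin f)) :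
    Nat.card (Σ S : {S : Set V // S.ncard = m},
      {Q : Set V // Q ⊆ S.1 ∧ isoClass (G.induce Q) = Quotient.mk finIsoSetoid ⟨f, F⟩}) =
    Nat.card {Q : Set V // isoClass (G.induce Q) = Quotient.mk finIsoSetoid ⟨f, F⟩} *
      Nat.card {S : Set W // S.ncard = m ∧ Q₀ ⊆ S} := by
  let e : (Σ S : {S : Set V // S.ncard = m},
      {Q : Set V // Q ⊆ S.1 ∧ isoClass (G.induce Q) = Quotient.mk finIsoSetoid ⟨f, F⟩}) ≃
      (Σ Q : {Q : Set V // isoClass (G.induce Q) = Quotient.mk finIsoSetoid ⟨f, F⟩},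
        {S : Set V // S.ncard = m ∧ Q.1 ⊆ S}) :=
    { toFun := fun x => ⟨⟨x.2.1, x.2.2.2⟩, ⟨x.1.1, x.1.2, x.2.2.1⟩⟩
      invFun := fun x => ⟨⟨x.2.1, x.2.2.1⟩, ⟨x.1.1, x.2.2.2, x.1.2⟩⟩
      left_inv := fun _ => rfl
      right_inv := fun _ => rfl }
  let _ := Fintype.ofFinite {Q : Set V // isoClass (G.induce Q) = Quotient.mk finIsoSetoid ⟨f, F⟩}
  rw [Nat.card_congr e, Nat.card_sigma, Nat.card_eq_fintype_card]
  simp_rw [fun Q : {Q : Set V // isoClass (G.induce Q) = Quotient.mk finIsoSetoid ⟨f, F⟩} =>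
    card_supersets_eq (Q' := Q₀) hW.symm
      ((ncard_eq_of_isoClass_induce_eq_mk Q.2).trans hQ₀.symm) m]
  simp

/-- Graphs of the same order with the same `m`-deck have the same number of induced copies of each
graph with at most `m` vertices. -/
lemma card_isoClass_eq_of_deck_eq [Finite V] [Finite V'] (hV : Nat.card V = Nat.card V') {m : ℕ}
    (hm : m ≤ Nat.card V) (hdeck : deck G m = deck G' m) {f : ℕ} (hf : f ≤ m)
    (F : SimpleGraph (Fin f)) :
    Nat.card {Q : Set V // isoClass (G.induce Q) = Quotient.mk finIsoSetoid ⟨f, F⟩} =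
      Nat.card {Q : Set V' // isoClass (G'.induce Q) = Quotient.mk finIsoSetoid ⟨f, F⟩} := by
  classical
  set q := Quotient.mk finIsoSetoid ⟨f, F⟩ with hq
  obtain ⟨e, he⟩ := exists_equiv_of_card_fiber_eq
    (fun S : {S : Set V // S.ncard = m} => isoClass (G.induce S.1))
    (fun S : {S : Set V' // S.ncard = m} => isoClass (G'.induce S.1)) (by
      intro c
      induction c using Quotient.ind with | _ c =>
      obtain ⟨r, R⟩ := c
      by_cases hr : r = m
      · subst hr
        rw [card_fiber_eq_deck, card_fiber_eq_deck, hdeck]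
      · have h1 : IsEmpty {S : {S : Set V // S.ncard = m} //
            isoClass (G.induce S.1) = Quotient.mk finIsoSetoid ⟨r, R⟩} :=
          ⟨fun S => hr (ncard_eq_of_isoClass_induce_eq_mk S.2 ▸ S.1.2)⟩
        have h2 : IsEmpty {S : {S : Set V' // S.ncard = m} //
            isoClass (G'.induce S.1) = Quotient.mk finIsoSetoid ⟨r, R⟩} :=
          ⟨fun S => hr (ncard_eq_of_isoClass_induce_eq_mk S.2 ▸ S.1.2)⟩
        rw [Nat.card_of_isEmpty, Nat.card_of_isEmpty])
  obtain ⟨Q₀, -, hQ₀⟩ := Set.exists_subset_card_eq (s := (Set.univ : Set (Fin (Nat.card V))))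
    (n := f) (by simpa [Set.ncard_univ] using hf.trans hm)
  obtain ⟨S₀, hS₀, -, hS₀'⟩ := Set.exists_subsuperset_card_eq (Set.subset_univ Q₀)
    (n := m) (by omega) (by simpa [Set.ncard_univ] using hm)
  have hpos : 0 < Nat.card {S : Set (Fin (Nat.card V)) // S.ncard = m ∧ Q₀ ⊆ S} :=
    Nat.card_pos_iff.mpr ⟨⟨S₀, hS₀', hS₀⟩, inferInstance⟩
  -- After multiplication by the common positive factor, both sides become sums over cards of the
  -- deck, which `e` matches card by card.
  refine Nat.eq_of_mul_eq_mul_right hpos ?_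
  rw [← card_sigma_copies (by simp) hQ₀ F, ← card_sigma_copies (by simp [hV]) hQ₀ F]
  let _ := Fintype.ofFinite {S : Set V // S.ncard = m}
  let _ := Fintype.ofFinite {S : Set V' // S.ncard = m}
  rw [Nat.card_sigma, Nat.card_sigma]
  exact Fintype.sum_equiv e _ _ fun S =>
    card_copies_eq_of_iso (isoClass_eq_iff.mp (he S).symm).some _

end IsoClasses

/-! ### The deck determines the maximal subtrees -/

section MaximalSubtrees

variable {V V' : Type*} {T : SimpleGraph V} {T' : SimpleGraph V'}

lemma Iso.dist_le {G : SimpleGraph V} {G' : SimpleGraph V'} (φ : G ≃g G') {u v : V}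
    (h : G.Reachable u v) : G'.dist (φ u) (φ v) ≤ G.dist u v := by
  obtain ⟨p, hp⟩ := h.exists_walk_length_eq_dist
  rw [← hp, ← Walk.length_map φ.toHom]
  exact SimpleGraph.dist_le (p.map φ.toHom)

lemma Iso.dist_eq {G : SimpleGraph V} {G' : SimpleGraph V'} (φ : G ≃g G') (h : G.Connected)
    (u v : V) : G'.dist (φ u) (φ v) = G.dist u v := by
  refine le_antisymm (φ.dist_le (h u v)) ?_
  have := φ.symm.dist_le ((φ.connected_iff.mp h) (φ u) (φ v))
  rwa [φ.symm_apply_apply, φ.symm_apply_apply] at this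

lemma IsTree.geodConvex_of_iso (hT : T.IsTree) (hT' : T'.IsTree) {S : Set V} {S' : Set V'}
    (φ : T.induce S ≃g T'.induce S') (hS : T.GeodConvex S) : T'.GeodConvex S' := by
  intro a ha
  exact (hT'.isTree_induce_iff.mp (φ.isTree_iff.mp
    (hT.isTree_induce_iff.mpr ⟨⟨_, (φ.symm ⟨a, ha⟩).2⟩, hS⟩))).2 a ha

lemma IsTree.dist_iso (hT : T.IsTree) (hT' : T'.IsTree) {S : Set V} {S' : Set V'}
    (φ : T.induce S ≃g T'.induce S') (hS : T.GeodConvex S) (s t : S) :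
    T'.dist (φ s : V') (φ t) = T.dist (s : V) t := by
  rw [← hT.dist_induce hS, ← hT'.dist_induce (hT.geodConvex_of_iso hT' φ hS),
    φ.dist_eq (hT.isTree_induce_iff.mpr ⟨⟨s, s.2⟩, hS⟩).connected]

lemma IsTree.isSubtree_of_iso (hT : T.IsTree) (hT' : T'.IsTree) {S : Set V} {S' : Set V'}
    (φ : T.induce S ≃g T'.induce S') {d : ℕ} (h : T.IsSubtree d S) : T'.IsSubtree d S' := by
  refine ⟨hT.geodConvex_of_iso hT' φ h.convex, fun a ha b hb => ?_, ?_⟩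
  · rw [← hT'.dist_iso hT φ.symm (hT.geodConvex_of_iso hT' φ h.convex) ⟨a, ha⟩ ⟨b, hb⟩]
    exact h.le _ (φ.symm _).2 _ (φ.symm _).2
  · obtain ⟨a, ha, b, hb, hab⟩ := h.exists_eq
    exact ⟨_, (φ ⟨a, ha⟩).2, _, (φ ⟨b, hb⟩).2, by rw [hT.dist_iso hT' φ h.convex, hab]⟩

/-- The number of induced copies of a subtree `q` of diameter `d` is obtained by summing over the
maximal subtrees of diameter `d`. -/
lemma IsTree.card_isoClass_eq_sum [Finite V] (hT : T.IsTree) {d : ℕ}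
    [Fintype {W // Maximal (T.IsSubtree d) W}] {q : Quotient finIsoSetoid}
    (hq : ∀ Q : Set V, isoClass (T.induce Q) = q → T.IsSubtree d Q) :
    Nat.card {Q : Set V // isoClass (T.induce Q) = q} =
      ∑ W : {W // Maximal (T.IsSubtree d) W},
        Nat.card {Q : Set V // Q ⊆ W.1 ∧ isoClass (T.induce Q) = q} := by
  rw [← Nat.card_sigma]
  choose! W hW hQW hmax using fun Q (h : T.IsSubtree d Q) => hT.exists_greatest_isSubtree h
  have hWmax : ∀ Q, T.IsSubtree d Q → Maximal (T.IsSubtree d) (W Q) := fun Q h =>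
    ⟨hW Q h, fun M hM hle => hmax Q h M hM ((hQW Q h).trans hle)⟩
  refine Nat.card_congr
    { toFun := fun Q => ⟨⟨W Q.1, hWmax _ (hq _ Q.2)⟩, ⟨Q.1, hQW _ (hq _ Q.2), Q.2⟩⟩
      invFun := fun x => ⟨x.2.1, x.2.2.2⟩
      left_inv := fun _ => rfl
      right_inv := ?_ }
  rintro ⟨⟨M, hM⟩, ⟨Q, hQM, hQ⟩⟩
  have : W Q = M := (hM.eq_of_le (hW _ (hq _ hQ)) (hmax _ (hq _ hQ) _ hM.prop hQM)).symm
  subst this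
  rfl

/-- A maximal subtree with at most `f` vertices contains a copy of `F` only if it is itself that
copy. -/
lemma IsTree.card_isoClass_eq_add [Finite V] (hT : T.IsTree) {d f : ℕ}
    {F : SimpleGraph (Fin f)}
    [Fintype {W : {W // Maximal (T.IsSubtree d) W} // f < W.1.ncard}]
    (hq : ∀ Q : Set V, isoClass (T.induce Q) = Quotient.mk finIsoSetoid ⟨f, F⟩ →
      T.IsSubtree d Q) :
    Nat.card {Q : Set V // isoClass (T.induce Q) = Quotient.mk finIsoSetoid ⟨f, F⟩} =
      ∑ W : {W : {W // Maximal (T.IsSubtree d) W} // f < W.1.ncard},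
        Nat.card {Q : Set V // Q ⊆ W.1.1 ∧
          isoClass (T.induce Q) = Quotient.mk finIsoSetoid ⟨f, F⟩} +
      Nat.card {W : {W // Maximal (T.IsSubtree d) W} //
        isoClass (T.induce W.1) = Quotient.mk finIsoSetoid ⟨f, F⟩} := by
  classical
  set q := Quotient.mk finIsoSetoid ⟨f, F⟩ with hqdef
  let _ := Fintype.ofFinite {W // Maximal (T.IsSubtree d) W}
  have key : ∀ W : {W // Maximal (T.IsSubtree d) W},
      Nat.card {Q : Set V // Q ⊆ W.1 ∧ isoClass (T.induce Q) = q} =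
      (if f < W.1.ncard then Nat.card {Q : Set V // Q ⊆ W.1 ∧ isoClass (T.induce Q) = q} else 0) +
      (if isoClass (T.induce W.1) = q then 1 else 0) := by
    intro W
    by_cases hf : f < W.1.ncard
    · have : isoClass (T.induce W.1) ≠ q := fun h => by
        have := ncard_eq_of_isoClass_induce_eq_mk h
        omega
      rw [if_pos hf, if_neg this, add_zero]
    · have heq : ∀ Q : Set V, Q ⊆ W.1 → isoClass (T.induce Q) = q → Q = W.1 := fun Q hQ h =>
        Set.eq_of_subset_of_ncard_le hQ (by rw [ncard_eq_of_isoClass_induce_eq_mk h]; omega)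
          (Set.toFinite _)
      rw [if_neg hf, zero_add]
      split_ifs with h
      · rw [Nat.card_eq_one_iff_unique]
        exact ⟨⟨fun A B => Subtype.ext ((heq _ A.2.1 A.2.2).trans (heq _ B.2.1 B.2.2).symm)⟩,
          ⟨W.1, subset_rfl, h⟩⟩
      · rw [Nat.card_eq_zero]
        exact Or.inl ⟨fun A => h (heq _ A.2.1 A.2.2 ▸ A.2.2)⟩
  rw [hT.card_isoClass_eq_sum hq, Finset.sum_congr rfl fun W _ => key W, Finset.sum_add_distrib,
    ← Finset.sum_filter, Finset.sum_boole, Nat.card_eq_fintype_card, Fintype.card_subtype,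
    Finset.sum_subtype _ (p := fun W : {W // Maximal (T.IsSubtree d) W} => f < W.1.ncard)
      (by simp)]
  rfl

/-- If all subtrees of diameter `d` have at most `m` vertices, then the `m`-deck of a tree
determines its maximal subtrees of diameter `d`. -/
lemma IsTree.exists_equiv_maximal [Finite V] [Finite V'] (hT : T.IsTree) (hT' : T'.IsTree)
    (hV : Nat.card V = Nat.card V') {m d : ℕ} (hm : m ≤ Nat.card V)
    (hdeck : deck T m = deck T' m) (h : ∀ S, T.IsSubtree d S → S.ncard ≤ m)
    (h' : ∀ S, T'.IsSubtree d S → S.ncard ≤ m) :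
    ∃ e : {W // Maximal (T.IsSubtree d) W} ≃ {W // Maximal (T'.IsSubtree d) W},
      ∀ W, Nonempty (T.induce W.1 ≃g T'.induce (e W).1) := by
  -- Descending induction on the size `f`, disguised as induction on `N`; for `N = 0` the size
  -- exceeds `m` and both sides vanish.
  suffices key : ∀ N f (F : SimpleGraph (Fin f)), m < f + N →
      Nat.card {W : {W // Maximal (T.IsSubtree d) W} //
        isoClass (T.induce W.1) = Quotient.mk finIsoSetoid ⟨f, F⟩} =
      Nat.card {W : {W // Maximal (T'.IsSubtree d) W} //
        isoClass (T'.induce W.1) = Quotient.mk finIsoSetoid ⟨f, F⟩} by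
    obtain ⟨e, he⟩ := exists_equiv_of_card_fiber_eq
      (fun W : {W // Maximal (T.IsSubtree d) W} => isoClass (T.induce W.1))
      (fun W : {W // Maximal (T'.IsSubtree d) W} => isoClass (T'.induce W.1)) (by
        intro c
        induction c using Quotient.ind with | _ c =>
        exact key (m + 1) c.1 c.2 (by omega))
    exact ⟨e, fun W => isoClass_eq_iff.mp (he W).symm⟩
  intro N
  induction N with
  | zero =>
    intro f F hf
    have h1 : IsEmpty {W : {W // Maximal (T.IsSubtree d) W} //
        isoClass (T.induce W.1) = Quotient.mk finIsoSetoid ⟨f, F⟩} := ⟨fun W => by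
      have := ncard_eq_of_isoClass_induce_eq_mk W.2
      have := h _ W.1.2.prop
      omega⟩
    have h2 : IsEmpty {W : {W // Maximal (T'.IsSubtree d) W} //
        isoClass (T'.induce W.1) = Quotient.mk finIsoSetoid ⟨f, F⟩} := ⟨fun W => by
      have := ncard_eq_of_isoClass_induce_eq_mk W.2
      have := h' _ W.1.2.prop
      omega⟩
    rw [Nat.card_of_isEmpty, Nat.card_of_isEmpty]
  | succ N ih =>
    intro f F hf
    rcases Nat.lt_or_ge m (f + N) with hlt | hge
    · exact ih f F hlt
    -- If `F` is the type of one subtree of diameter `d`, then all its copies in both trees are such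
    -- subtrees; otherwise there is nothing to count.
    by_cases hq : (∃ Q, T.IsSubtree d Q ∧ isoClass (T.induce Q) = Quotient.mk finIsoSetoid ⟨f, F⟩) ∨
      ∃ Q, T'.IsSubtree d Q ∧ isoClass (T'.induce Q) = Quotient.mk finIsoSetoid ⟨f, F⟩
    · have hq1 : ∀ Q : Set V, isoClass (T.induce Q) = Quotient.mk finIsoSetoid ⟨f, F⟩ →
          T.IsSubtree d Q := by
        intro Q hQ
        rcases hq with ⟨R, hR, hR'⟩ | ⟨R, hR, hR'⟩
        · exact hT.isSubtree_of_iso hT (isoClass_eq_iff.mp (hR'.trans hQ.symm)).some hR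
        · exact hT'.isSubtree_of_iso hT (isoClass_eq_iff.mp (hR'.trans hQ.symm)).some hR
      have hq2 : ∀ Q : Set V', isoClass (T'.induce Q) = Quotient.mk finIsoSetoid ⟨f, F⟩ →
          T'.IsSubtree d Q := by
        intro Q hQ
        rcases hq with ⟨R, hR, hR'⟩ | ⟨R, hR, hR'⟩
        · exact hT.isSubtree_of_iso hT' (isoClass_eq_iff.mp (hR'.trans hQ.symm)).some hR
        · exact hT'.isSubtree_of_iso hT' (isoClass_eq_iff.mp (hR'.trans hQ.symm)).some hR
      let _ := Fintype.ofFinite {W : {W // Maximal (T.IsSubtree d) W} // f < W.1.ncard}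
      let _ := Fintype.ofFinite {W : {W // Maximal (T'.IsSubtree d) W} // f < W.1.ncard}
      have hN := card_isoClass_eq_of_deck_eq hV hm hdeck (by omega) F
      rw [hT.card_isoClass_eq_add hq1, hT'.card_isoClass_eq_add hq2] at hN
      obtain ⟨e, he⟩ := exists_equiv_of_card_fiber_eq
        (fun W : {W : {W // Maximal (T.IsSubtree d) W} // f < W.1.ncard} =>
          isoClass (T.induce W.1.1))
        (fun W : {W : {W // Maximal (T'.IsSubtree d) W} // f < W.1.ncard} =>
          isoClass (T'.induce W.1.1)) (by
          intro c
          induction c using Quotient.ind with | _ c =>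
          obtain ⟨r, R⟩ := c
          by_cases hr : f < r
          · have e1 := Nat.card_congr (Equiv.subtypeSubtypeEquivSubtype
              (p := fun W : {W // Maximal (T.IsSubtree d) W} => f < W.1.ncard)
              (q := fun W => isoClass (T.induce W.1) = Quotient.mk finIsoSetoid ⟨r, R⟩)
              fun {W} hW => by rw [ncard_eq_of_isoClass_induce_eq_mk hW]; exact hr)
            have e2 := Nat.card_congr (Equiv.subtypeSubtypeEquivSubtype
              (p := fun W : {W // Maximal (T'.IsSubtree d) W} => f < W.1.ncard)
              (q := fun W => isoClass (T'.induce W.1) = Quotient.mk finIsoSetoid ⟨r, R⟩)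
              fun {W} hW => by rw [ncard_eq_of_isoClass_induce_eq_mk hW]; exact hr)
            exact e1.trans ((ih r R (by omega)).trans e2.symm)
          · have h1 : IsEmpty {W : {W : {W // Maximal (T.IsSubtree d) W} // f < W.1.ncard} //
                isoClass (T.induce W.1.1) = Quotient.mk finIsoSetoid ⟨r, R⟩} :=
              ⟨fun W => hr (ncard_eq_of_isoClass_induce_eq_mk W.2 ▸ W.1.2)⟩
            have h2 : IsEmpty {W : {W : {W // Maximal (T'.IsSubtree d) W} // f < W.1.ncard} //
                isoClass (T'.induce W.1.1) = Quotient.mk finIsoSetoid ⟨r, R⟩} :=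
              ⟨fun W => hr (ncard_eq_of_isoClass_induce_eq_mk W.2 ▸ W.1.2)⟩
            rw [Nat.card_of_isEmpty, Nat.card_of_isEmpty])
      rw [Fintype.sum_equiv e _ (fun W => Nat.card {Q : Set V' // Q ⊆ W.1.1 ∧
          isoClass (T'.induce Q) = Quotient.mk finIsoSetoid ⟨f, F⟩}) fun W =>
        card_copies_eq_of_iso (isoClass_eq_iff.mp (he W).symm).some _] at hN
      exact Nat.add_left_cancel hN
    · push Not at hq
      have h1 : IsEmpty {W : {W // Maximal (T.IsSubtree d) W} //
          isoClass (T.induce W.1) = Quotient.mk finIsoSetoid ⟨f, F⟩} :=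
        ⟨fun W => hq.1 _ W.1.2.prop W.2⟩
      have h2 : IsEmpty {W : {W // Maximal (T'.IsSubtree d) W} //
          isoClass (T'.induce W.1) = Quotient.mk finIsoSetoid ⟨f, F⟩} :=
        ⟨fun W => hq.2 _ W.1.2.prop W.2⟩
      rw [Nat.card_of_isEmpty, Nat.card_of_isEmpty]

end MaximalSubtrees

end SimpleGraph

namespace SimpleGraph

/-! ### Transferring the level and the spider condition -/

section Transfer

variable {V V' : Type*} {T : SimpleGraph V} {T' : SimpleGraph V'}

lemma exists_iso_of_deck_eq [Finite V] [Finite V'] (hV : Nat.card V = Nat.card V') {m : ℕ}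
    (hm : m ≤ Nat.card V) (hdeck : deck T m = deck T' m) {S : Set V} (hS : S.ncard ≤ m) :
    ∃ S' : Set V', Nonempty (T.induce S ≃g T'.induce S') := by
  have h := card_isoClass_eq_of_deck_eq hV hm hdeck
    (by rwa [Nat.card_coe_set_eq] : Nat.card S ≤ m)
    ((T.induce S).map (Finite.equivFin S).toEmbedding)
  have h0 : 0 < Nat.card {Q : Set V // isoClass (T.induce Q) = isoClass (T.induce S)} :=
    Nat.card_pos_iff.mpr ⟨⟨S, rfl⟩, inferInstance⟩
  obtain ⟨⟨⟨Q, hQ⟩⟩, -⟩ := Nat.card_pos_iff.mp (lt_of_lt_of_eq h0 h)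
  exact ⟨Q, isoClass_eq_iff.mp (Eq.symm hQ)⟩

/-- A subtree of `T'` with at least `m` vertices can be pruned, keeping a diametral path, to exactly
`m` vertices. This card of the deck also occurs in `T`, against the bound there. -/
lemma IsTree.isSubtree_transfer [Finite V] [Finite V'] (hT : T.IsTree) (hT' : T'.IsTree)
    (hV : Nat.card V = Nat.card V') {m : ℕ} (hm : m ≤ Nat.card V)
    (hdeck : deck T m = deck T' m) {d : ℕ} (h : ∃ S, T.IsSubtree d S)
    (hlt : ∀ S, T.IsSubtree d S → S.ncard < m) :
    (∃ S, T'.IsSubtree d S) ∧ ∀ S, T'.IsSubtree d S → S.ncard < m := by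
  obtain ⟨S, hS⟩ := h
  have hSm := hlt S hS
  have hdS := hT.lt_ncard hS
  obtain ⟨S', ⟨φ⟩⟩ := exists_iso_of_deck_eq hV hm hdeck hSm.le
  refine ⟨⟨S', hT.isSubtree_of_iso hT' φ hS⟩, fun W hW => ?_⟩
  by_contra! hle
  obtain ⟨M, hM, hMm⟩ := hT'.exists_isSubtree_ncard_eq hW (m := m) (by omega) hle
  obtain ⟨M', ⟨ψ⟩⟩ := exists_iso_of_deck_eq hV.symm (hV ▸ hm) hdeck.symm hMm.le
  have h1 := hlt M' (hT'.isSubtree_of_iso hT ψ hM)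
  have h2 := Nat.card_congr ψ.toEquiv
  rw [Nat.card_coe_set_eq, Nat.card_coe_set_eq] at h2
  omega

lemma IsTree.isVineLevel_transfer [Finite V] [Finite V'] (hT : T.IsTree) (hT' : T'.IsTree)
    (hV : Nat.card V = Nat.card V') {ℓ k : ℕ}
    (hdeck : deck T (Nat.card V - ℓ) = deck T' (Nat.card V - ℓ)) (hk : IsVineLevel T ℓ k) :
    IsVineLevel T' ℓ k := by
  have hset : {j : ℕ | (∃ S, IsEvine T j S) ∧ ∀ S, IsEvine T j S → S.ncard < Nat.card V - ℓ} =
      {j : ℕ | (∃ S, IsEvine T' j S) ∧ ∀ S, IsEvine T' j S → S.ncard < Nat.card V' - ℓ} := by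
    ext j
    simp only [IsEvine, hT.isSubtree_iff, hT'.isSubtree_iff, Set.mem_ofPred_eq, ← hV]
    exact ⟨fun h => hT.isSubtree_transfer hT' hV (Nat.sub_le _ _) hdeck h.1 h.2,
      fun h => hT'.isSubtree_transfer hT hV.symm (by omega) hdeck.symm h.1 h.2⟩
  unfold IsVineLevel
  rw [← hset]
  exact hk

lemma IsTree.ncard_lt_of_geodConvex [Finite V] (hT : T.IsTree) {e m : ℕ}
    (h : ∃ S, T.IsSubtree e S) (hlt : ∀ S, T.IsSubtree e S → S.ncard < m) {S : Set V}
    (hS : T.GeodConvex S) (hne : S.Nonempty) (hle : ∀ a ∈ S, ∀ b ∈ S, T.dist a b ≤ e) :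
    S.ncard < m := by
  obtain ⟨R, hR⟩ := h
  obtain ⟨a, -, b, -, hab⟩ := hR.exists_eq
  obtain ⟨W, hSW, hW⟩ := hT.exists_isSubtree_of_le hS hne hle ⟨a, b, hab.ge⟩
  exact (Set.ncard_le_ncard hSW (Set.toFinite _)).trans_lt (hlt W hW)

/-- The closed ball of radius `r` around `c`. -/
def cball (T : SimpleGraph V) (c : V) (r : ℕ) : Set V := {v | T.dist c v ≤ r}

@[simp]
lemma mem_cball {c v : V} {r : ℕ} : v ∈ T.cball c r ↔ T.dist c v ≤ r := Iff.rfl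

lemma IsTree.geodConvex_cball (hT : T.IsTree) (c : V) (r : ℕ) : T.GeodConvex (T.cball c r) :=
  fun _ ha _ hb _ h => hT.dist_le_of_between h ha hb

lemma IsTree.dist_le_of_mem_cball (hT : T.IsTree) {c a b : V} {r : ℕ} (ha : a ∈ T.cball c r)
    (hb : b ∈ T.cball c r) : T.dist a b ≤ 2 * r := by
  have := hT.connected.dist_triangle (u := a) (v := c) (w := b)
  rw [mem_cball] at ha hb
  rw [T.dist_comm (u := a) (v := c)] at this
  omega

lemma self_mem_cball (c : V) (r : ℕ) : c ∈ T.cball c r := by simp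

lemma dist_spider_le {j : ℕ} (i : Fin 3) (a : Fin j) (hT : T.IsTree)
    (f : spider (fun _ : Fin 3 => j) →g T) : T.dist (f none) (f (some ⟨i, a⟩)) ≤ a + 1 := by
  obtain ⟨a, ha⟩ := a
  induction a with
  | zero =>
    have : (spider fun _ : Fin 3 => j).Adj none (some ⟨i, 0, ha⟩) := by
      simp [spider]
    exact (dist_eq_one_iff_adj.mpr (f.map_adj this)).le
  | succ a ih =>
    have : (spider fun _ : Fin 3 => j).Adj (some ⟨i, a, by omega⟩) (some ⟨i, a + 1, ha⟩) := by
      simp [spider]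
    have h1 := dist_eq_one_iff_adj.mpr (f.map_adj this)
    have h2 := ih (by omega)
    have h3 := hT.connected.dist_triangle (u := f none) (v := f (some ⟨i, a, by omega⟩))
      (w := f (some ⟨i, a + 1, ha⟩))
    simp only at h2 ⊢
    omega

/-- The spider lies in the ball of radius `j` around its branch vertex. That ball has diameter at
most `2j ≤ e`, so it is small enough to be found in `T'`. -/
lemma IsTree.containsThreeSpider_transfer [Finite V] [Finite V'] (hT : T.IsTree)
    (hV : Nat.card V = Nat.card V') {m : ℕ} (hm : m ≤ Nat.card V)
    (hdeck : deck T m = deck T' m) {e j : ℕ} (hje : 2 * j ≤ e) (h : ∃ S, T.IsSubtree e S)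
    (hlt : ∀ S, T.IsSubtree e S → S.ncard < m) (hS : ContainsThreeSpider T j) :
    ContainsThreeSpider T' j := by
  obtain ⟨f⟩ := hS
  set B := T.cball (f none) j
  obtain ⟨S', ⟨φ⟩⟩ := exists_iso_of_deck_eq hV hm hdeck (hT.ncard_lt_of_geodConvex h hlt
    (hT.geodConvex_cball (f none) j) ⟨f none, self_mem_cball _ _⟩
    fun a ha b hb => (hT.dist_le_of_mem_cball ha hb).trans hje).le
  have hmem : ∀ x, f x ∈ B := by
    rintro (_ | ⟨i, a⟩)
    · exact self_mem_cball _ _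
    · exact (dist_spider_le i a hT f.toHom).trans a.2
  have h1 : (spider fun _ : Fin 3 => j).IsContained (T.induce B) :=
    ⟨⟨⟨fun x => ⟨f x, hmem x⟩, fun h => f.toHom.map_adj h⟩,
      fun x y hxy => f.injective (congrArg Subtype.val hxy)⟩⟩
  exact h1.trans (IsContained.trans ⟨φ.toCopy⟩ ⟨(Embedding.induce S').toCopy⟩)

/-- The legs are initial segments of the geodesics from `c` to the `p i`. A common vertex of two
legs would be a shortcut avoiding `c`. -/
lemma IsTree.containsThreeSpider_of_dist (hT : T.IsTree) {j : ℕ} {c : V} {p : Fin 3 → V}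
    (hp : ∀ i, j ≤ T.dist c (p i))
    (hc : ∀ i l, i ≠ l → T.dist (p i) c + T.dist c (p l) = T.dist (p i) (p l)) :
    ContainsThreeSpider T j := by
  choose q hq using fun i => hT.connected.exists_walk_length_eq_dist c (p i)
  have hpath : ∀ i, (q i).IsPath := fun i => (q i).isPath_of_length_eq_dist (hq i)
  have hd : ∀ i a, a ≤ j → T.dist c ((q i).getVert a) = a ∧
      T.dist c ((q i).getVert a) + T.dist ((q i).getVert a) (p i) = T.dist c (p i) := by
    intro i a ha
    have h1 : T.dist c ((q i).getVert a) ≤ a := (dist_le ((q i).take a)).trans (by simp)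
    have h2 : T.dist ((q i).getVert a) (p i) ≤ T.dist c (p i) - a :=
      (dist_le ((q i).drop a)).trans (by simp [hq])
    have h3 := hT.connected.dist_triangle (u := c) (v := (q i).getVert a) (w := p i)
    have := hp i
    omega
  let f : Option (Σ _ : Fin 3, Fin j) → V
    | none => c
    | some x => (q x.1).getVert (x.2 + 1)
  have h0 : ∀ i (a : Fin j), (a : ℕ) = 0 → T.Adj c ((q i).getVert (a + 1)) := by
    intro i a ha
    have := (q i).adj_getVert_succ (i := 0) (by rw [hq]; have := hp i; omega)
    simpa [ha] using this
  have h1 : ∀ i (a b : Fin j), (b : ℕ) = a + 1 →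
      T.Adj ((q i).getVert (a + 1)) ((q i).getVert (b + 1)) := by
    intro i a b hb
    rw [hb]
    exact (q i).adj_getVert_succ (i := a + 1) (by rw [hq]; have := hp i; omega)
  refine ⟨⟨⟨f, fun {x y} h => ?_⟩, ?_⟩⟩
  · rw [spider, fromRel_adj] at h
    obtain ⟨-, h⟩ := h
    rcases x with _ | ⟨i, a⟩ <;> rcases y with _ | ⟨l, b⟩
    · exact (h.elim id id).elim
    · exact h0 l b (h.resolve_right id)
    · exact (h0 i a (h.resolve_left id)).symm
    · rcases h with ⟨rfl : i = l, h⟩ | ⟨rfl : l = i, h⟩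
      · exact h1 i a b h
      · exact (h1 l b a h).symm
  · have hnone : ∀ i (a : Fin j), c ≠ (q i).getVert (a + 1) := fun i a h => by
      have := (hd i (a + 1) a.2).1
      rw [← h, dist_self] at this
      omega
    rintro (_ | ⟨i, a⟩) (_ | ⟨l, b⟩) h
    · rfl
    · exact absurd h (hnone l b)
    · exact absurd h.symm (hnone i a)
    · change (q i).getVert (a + 1) = (q l).getVert (b + 1) at h
      obtain ⟨h1, h2⟩ := hd i (a + 1) a.2
      obtain ⟨h3, h4⟩ := hd l (b + 1) b.2
      rw [← h] at h3 h4
      have hab : a = b := Fin.ext (by omega)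
      subst hab
      by_cases hil : i = l
      · rw [hil]
      · have h5 := hc i l hil
        have h6 := hT.connected.dist_triangle (u := p i) (v := (q i).getVert (a + 1)) (w := p l)
        rw [T.dist_comm (u := p i) (v := c)] at h5
        rw [T.dist_comm (u := p i) (v := (q i).getVert (a + 1))] at h6
        omega

end Transfer

end SimpleGraph

namespace SimpleGraph

/-! ### Maximal vines and evines as balls -/

section Balls

variable {V : Type*} {T : SimpleGraph V}

lemma IsTree.dist_le_of_midpoint (hT : T.IsTree) {j : ℕ} {W : Set V}
    (hW : ∀ s ∈ W, ∀ t ∈ W, T.dist s t ≤ 2 * j) {a b c : V} (ha : a ∈ W) (hb : b ∈ W)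
    (hac : T.dist a c = j) (hcb : T.dist c b = j) (hab : T.dist a b = 2 * j) {s : V}
    (hs : s ∈ W) : T.dist c s ≤ j := by
  have h1 := hW a ha s hs
  have h2 := hW s hs b hb
  have e := T.dist_comm (u := c) (v := s)
  rcases hT.dist_or (a := a) (b := b) (c := c) (by omega) s with h | h <;> omega

lemma IsTree.isSubtree_cball (hT : T.IsTree) {j : ℕ} {a b c : V} (ha : T.dist a c ≤ j)
    (hb : T.dist c b ≤ j) (hab : T.dist a b = 2 * j) : T.IsSubtree (2 * j) (T.cball c j) :=
  ⟨hT.geodConvex_cball c j, fun _ hs _ ht => hT.dist_le_of_mem_cball hs ht,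
    a, by rwa [mem_cball, dist_comm], b, hb, hab⟩

/-- The two ends of a diametral path of a ball of diameter `2j`. -/
lemma IsTree.exists_of_isSubtree_cball (hT : T.IsTree) {j : ℕ} {c : V}
    (h : T.IsSubtree (2 * j) (T.cball c j)) :
    ∃ a b, T.dist a c = j ∧ T.dist c b = j ∧ T.dist a b = 2 * j := by
  obtain ⟨a, ha, b, hb, hab⟩ := h.exists_eq
  rw [mem_cball] at ha hb
  rw [dist_comm] at ha
  have := hT.connected.dist_triangle (u := a) (v := c) (w := b)
  exact ⟨a, b, by omega, by omega, hab⟩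

/-- Seen from any `u`, at least one of the two diametral ends lies behind the center `c`. -/
lemma IsTree.exists_dist_eq_add (hT : T.IsTree) {j : ℕ} {c : V}
    (h : T.IsSubtree (2 * j) (T.cball c j)) (u : V) :
    ∃ a, T.dist c a = j ∧ T.dist u a = T.dist u c + j := by
  obtain ⟨a, b, ha, hb, hab⟩ := hT.exists_of_isSubtree_cball h
  rcases hT.dist_or (a := a) (b := b) (c := c) (by omega) u with h | h
  · rw [T.dist_comm (u := a) (v := c), T.dist_comm (u := c) (v := u),
      T.dist_comm (u := a) (v := u)] at h
    rw [T.dist_comm (u := a) (v := c)] at ha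
    exact ⟨a, by omega, by omega⟩
  · exact ⟨b, by omega, by omega⟩

lemma IsTree.maximal_cball (hT : T.IsTree) {j : ℕ} {c : V}
    (h : T.IsSubtree (2 * j) (T.cball c j)) : Maximal (T.IsSubtree (2 * j)) (T.cball c j) := by
  refine ⟨h, fun M hM hle s hs => ?_⟩
  obtain ⟨a, b, ha, hb, hab⟩ := hT.exists_of_isSubtree_cball h
  exact hT.dist_le_of_midpoint hM.le (hle (by rw [mem_cball, dist_comm, ha]))
    (hle (by rw [mem_cball, hb])) ha hb hab hs

lemma IsTree.eq_cball_of_maximal (hT : T.IsTree) {j : ℕ} {W : Set V} {c : V}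
    (hW : Maximal (T.IsSubtree (2 * j)) W) (hc : ∀ s ∈ W, T.dist c s ≤ j) :
    W = T.cball c j := by
  obtain ⟨a, ha, b, hb, hab⟩ := hW.prop.exists_eq
  exact hW.eq_of_le (hT.isSubtree_cball (dist_comm (G := T) ▸ hc a ha) (hc b hb) hab) hc

lemma IsTree.geodConvex_union_cball (hT : T.IsTree) {j : ℕ} {c u : V} (h : T.Adj c u) :
    T.GeodConvex (T.cball c j ∪ T.cball u j) := by
  have hcu : T.dist c u = 1 := dist_eq_one_iff_adj.mpr h
  have key : ∀ a ∈ T.cball c j, ∀ b ∈ T.cball u j, ∀ x,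
      T.dist a x + T.dist x b = T.dist a b → x ∈ T.cball c j ∪ T.cball u j := by
    intro a ha b hb x hx
    rw [mem_cball] at ha hb
    rw [Set.mem_union, mem_cball, mem_cball]
    have e1 := T.dist_comm (u := c) (v := x)
    have e2 := T.dist_comm (u := c) (v := a)
    have h1 := hT.connected.dist_triangle (u := c) (v := u) (w := b)
    rcases hT.dist_or hx c with h2 | h2
    · left; omega
    · by_cases h3 : T.dist c x ≤ j
      · exact Or.inl h3
      · have : T.dist x b = 0 := by omega
        rw [hT.connected.dist_eq_zero_iff.mp this]
        exact Or.inr hb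
  rintro a (ha | ha) b (hb | hb) x hx
  · exact Or.inl (hT.geodConvex_cball c j a ha b hb x hx)
  · exact key a ha b hb x hx
  · refine key b hb a ha x ?_
    rw [T.dist_comm (u := b) (v := x), T.dist_comm (u := x) (v := a),
      T.dist_comm (u := b) (v := a)]
    omega
  · exact Or.inr (hT.geodConvex_cball u j a ha b hb x hx)

/-- The diametral path runs from a vertex behind `c` to a vertex behind `u`. A vertex within `2j+1`
of both its ends is within `j` of `c` or of `u`. -/
lemma IsTree.maximal_union_cball (hT : T.IsTree) {j : ℕ} {c u : V} (h : T.Adj c u)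
    (hc : T.IsSubtree (2 * j) (T.cball c j)) (hu : T.IsSubtree (2 * j) (T.cball u j)) :
    Maximal (T.IsSubtree (2 * j + 1)) (T.cball c j ∪ T.cball u j) := by
  have hcu : T.dist c u = 1 := dist_eq_one_iff_adj.mpr h
  have huc : T.dist u c = 1 := dist_eq_one_iff_adj.mpr h.symm
  obtain ⟨a, ha, ha'⟩ := hT.exists_dist_eq_add hc u
  obtain ⟨b, hb, hb'⟩ := hT.exists_dist_eq_add hu c
  have e1 := T.dist_comm (u := c) (v := a)
  have e2 := T.dist_comm (u := u) (v := a)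
  have hab : T.dist a b = 2 * j + 1 := by
    have e3 := T.dist_comm (u := b) (v := a)
    have e4 := T.dist_comm (u := b) (v := c)
    rcases hT.dist_or (a := u) (b := a) (c := c) (by omega) b with h | h <;> omega
  have hdiam : ∀ s ∈ T.cball c j, ∀ t ∈ T.cball u j, T.dist s t ≤ 2 * j + 1 := by
    intro s hs t ht
    rw [mem_cball] at hs ht
    have h1 := hT.connected.dist_triangle (u := s) (v := c) (w := t)
    have h2 := hT.connected.dist_triangle (u := c) (v := u) (w := t)
    have e3 := T.dist_comm (u := s) (v := c)
    omega
  refine ⟨⟨hT.geodConvex_union_cball h, ?_, a, Or.inl ha.le, b, Or.inr hb.le, hab⟩, ?_⟩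
  · rintro s (hs | hs) t (ht | ht)
    · exact (hT.dist_le_of_mem_cball hs ht).trans (Nat.le_succ _)
    · exact hdiam s hs t ht
    · exact dist_comm (G := T) ▸ hdiam t ht s hs
    · exact (hT.dist_le_of_mem_cball hs ht).trans (Nat.le_succ _)
  · intro M hM hle s hs
    have h1 := hM.le a (hle (Or.inl ha.le)) s hs
    have h2 := hM.le s hs b (hle (Or.inr hb.le))
    have h3 := hT.dist_ne_of_adj s h
    have e3 := T.dist_comm (u := s) (v := c)
    have e4 := T.dist_comm (u := s) (v := u)
    rw [Set.mem_union, mem_cball, mem_cball]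
    rcases hT.dist_or (a := a) (b := b) (c := c) (by omega) s with h4 | h4 <;>
      rcases hT.dist_or (a := a) (b := b) (c := u) (by omega) s with h5 | h5 <;> omega

lemma IsTree.isSubtree_cball_of_adj (hT : T.IsTree) {j : ℕ} {c u a b : V} (h : T.Adj c u)
    (ha : T.dist a c ≤ j) (hb : T.dist u b ≤ j) (hab : T.dist a b = 2 * j + 1) :
    T.IsSubtree (2 * j) (T.cball c j) := by
  have hcu : T.dist c u = 1 := dist_eq_one_iff_adj.mpr h
  have h1 := hT.connected.dist_triangle (u := a) (v := c) (w := b)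
  have h2 := hT.connected.dist_triangle (u := c) (v := u) (w := b)
  obtain ⟨p, hp, hp'⟩ := hT.exists_dist_eq (a := c) (b := b) (i := j) (by omega)
  have h3 := hT.connected.dist_triangle (u := a) (v := p) (w := b)
  have h4 := hT.connected.dist_triangle (u := a) (v := c) (w := p)
  exact hT.isSubtree_cball ha hp.le (by omega)

/-- Two vertices of one ball are at most `2j` apart, so the ends of a diametral path of `W` lie in
different balls, and each of `c`, `u` is the center of a `j`-vine. -/
lemma IsTree.eq_union_cball_of_maximal (hT : T.IsTree) {j : ℕ} {W : Set V} {c u : V}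
    (h : T.Adj c u) (hW : Maximal (T.IsSubtree (2 * j + 1)) W)
    (hcu : ∀ s ∈ W, T.dist c s ≤ j ∨ T.dist u s ≤ j) :
    T.IsSubtree (2 * j) (T.cball c j) ∧ T.IsSubtree (2 * j) (T.cball u j) ∧
      W = T.cball c j ∪ T.cball u j := by
  obtain ⟨a, ha, b, hb, hab⟩ := hW.prop.exists_eq
  have key : ∀ a b, T.dist a b = 2 * j + 1 → T.dist c a ≤ j → T.dist u b ≤ j →
      T.IsSubtree (2 * j) (T.cball c j) ∧ T.IsSubtree (2 * j) (T.cball u j) := by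
    intro a b hab ha hb
    rw [dist_comm] at ha
    refine ⟨hT.isSubtree_cball_of_adj h ha hb hab, hT.isSubtree_cball_of_adj h.symm (a := b)
      (b := a) ?_ ?_ ?_⟩ <;> rwa [dist_comm]
  have hboth : T.IsSubtree (2 * j) (T.cball c j) ∧ T.IsSubtree (2 * j) (T.cball u j) := by
    rcases hcu a ha with h1 | h1 <;> rcases hcu b hb with h2 | h2
    · have := hT.dist_le_of_mem_cball (mem_cball.mpr h1) (mem_cball.mpr h2)
      omega
    · exact key a b hab h1 h2
    · exact key b a (dist_comm (G := T) ▸ hab) h2 h1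
    · have := hT.dist_le_of_mem_cball (mem_cball.mpr h1) (mem_cball.mpr h2)
      omega
  exact ⟨hboth.1, hboth.2, hW.eq_of_le (hT.maximal_union_cball h hboth.1 hboth.2).prop hcu⟩

end Balls

/-! ### Counting edges by the type of the ball around one end -/

section RootedIso

variable {V V' V₀ : Type*} {T : SimpleGraph V} {T' : SimpleGraph V'} {T₀ : SimpleGraph V₀}

/-- There is an isomorphism between the balls of radius `j` around `c` and `c'` that maps `c` to
`c'` and `u` to `u'`. -/
def RootedIso (T : SimpleGraph V) (T' : SimpleGraph V') (j : ℕ) (p : V × V) (p' : V' × V') :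
    Prop :=
  ∃ φ : T.induce (T.cball p.1 j) ≃g T'.induce (T'.cball p'.1 j), ∃ h : p.2 ∈ T.cball p.1 j,
    (φ ⟨p.1, self_mem_cball p.1 j⟩ : V') = p'.1 ∧ (φ ⟨p.2, h⟩ : V') = p'.2

lemma RootedIso.symm {j : ℕ} {p : V × V} {p' : V' × V'} (h : RootedIso T T' j p p') :
    RootedIso T' T j p' p := by
  obtain ⟨φ, h, h1, h2⟩ := h
  have h1' : φ ⟨p.1, self_mem_cball p.1 j⟩ = ⟨p'.1, self_mem_cball p'.1 j⟩ := Subtype.ext h1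
  have hmem : p'.2 ∈ T'.cball p'.1 j := h2 ▸ (φ _).2
  have h2' : φ ⟨p.2, h⟩ = ⟨p'.2, hmem⟩ := Subtype.ext h2
  exact ⟨φ.symm, hmem, by rw [← h1', φ.symm_apply_apply], by rw [← h2', φ.symm_apply_apply]⟩

lemma RootedIso.trans {j : ℕ} {p : V × V} {p' : V' × V'} {p₀ : V₀ × V₀}
    (h : RootedIso T T' j p p') (h' : RootedIso T' T₀ j p' p₀) : RootedIso T T₀ j p p₀ := by
  obtain ⟨φ, h, h1, h2⟩ := h
  obtain ⟨ψ, h', h3, h4⟩ := h'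
  refine ⟨φ.trans ψ, h, ?_, ?_⟩
  · exact (congrArg (fun x => (ψ x : V₀)) (Subtype.ext h1)).trans h3
  · exact (congrArg (fun x => (ψ x : V₀)) (Subtype.ext h2)).trans h4

lemma IsTree.rootedIso_of_iso (hT : T.IsTree) (hT' : T'.IsTree) {j : ℕ} {W : Set V} {W' : Set V'}
    (φ : T.induce W ≃g T'.induce W') (hW : T.GeodConvex W) (s t : W)
    (hs : T.cball (s : V) j ⊆ W) (hs' : T'.cball (φ s : V') j ⊆ W')
    (ht : T.dist (s : V) t ≤ j) : RootedIso T T' j (s, t) (φ s, φ t) :=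
  ⟨φ.restrictInduce hs hs' fun x => by
    rw [mem_cball, mem_cball, hT.dist_iso hT' φ hW], ht, rfl, rfl⟩

/-- Isomorphic families of vertex sets have the same number of locally determined pairs. -/
lemma card_le_of_local [Finite V'] {P : Set V → Prop} {P' : Set V' → Prop}
    (e : {W // P W} ≃ {W // P' W}) (φ : ∀ W, T.induce W.1 ≃g T'.induce (e W).1)
    (A : Set V → V × V → Prop) (A' : Set V' → V' × V' → Prop)
    (hmem : ∀ W p, A W p → p.1 ∈ W ∧ p.2 ∈ W)
    (htrans : ∀ W (s t : W.1), A W.1 (s, t) → A' (e W).1 (φ W s, φ W t))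
    (huniq : ∀ W₁ W₂ p, P' W₁ → P' W₂ → A' W₁ p → A' W₂ p → W₁ = W₂) :
    {p | ∃ W, P W ∧ A W p}.ncard ≤ {p | ∃ W, P' W ∧ A' W p}.ncard := by
  choose W hW using fun p : {p | ∃ W, P W ∧ A W p} => p.2
  rw [← Nat.card_coe_set_eq, ← Nat.card_coe_set_eq]
  -- Each pair is moved by the isomorphism of a set containing it. By `huniq` the image pair
  -- determines its set, so the map is injective.
  refine Nat.card_le_card_of_injective (fun p => ⟨(φ ⟨W p, (hW p).1⟩ ⟨p.1.1, (hmem _ _ (hW p).2).1⟩,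
    φ ⟨W p, (hW p).1⟩ ⟨p.1.2, (hmem _ _ (hW p).2).2⟩), (e ⟨W p, (hW p).1⟩).1,
      (e ⟨W p, (hW p).1⟩).2, htrans _ _ _ (hW p).2⟩) ?_
  intro p q hpq
  have hpq' := congrArg Subtype.val hpq
  have hWW : W p = W q := by
    have h1 := htrans ⟨W p, (hW p).1⟩ ⟨p.1.1, (hmem _ _ (hW p).2).1⟩
      ⟨p.1.2, (hmem _ _ (hW p).2).2⟩ (hW p).2
    have h2 := htrans ⟨W q, (hW q).1⟩ ⟨q.1.1, (hmem _ _ (hW q).2).1⟩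
      ⟨q.1.2, (hmem _ _ (hW q).2).2⟩ (hW q).2
    simp only at hpq'
    rw [hpq'] at h1
    exact congrArg Subtype.val (e.injective (Subtype.ext (huniq _ _ _ (e _).2 (e _).2 h1 h2)))
  have key : ∀ (A B : {W // P W}) (_ : A = B) (a : A.1) (b : B.1),
      (φ A a : V') = φ B b → (a : V) = b := by
    rintro A _ rfl a b h
    exact congrArg Subtype.val ((φ A).injective (Subtype.ext h))
  exact Subtype.ext (Prod.ext (key _ _ (Subtype.ext hWW) _ _ (congrArg Prod.fst hpq'))
    (key _ _ (Subtype.ext hWW) _ _ (congrArg Prod.snd hpq')))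

lemma IsTree.isSubtree_cball_of_rootedIso [Finite V] [Finite V'] (hT : T.IsTree) (hT' : T'.IsTree)
    {j : ℕ} {p : V × V} {p' : V' × V'} (h : RootedIso T T' j p p')
    (hp : T.IsSubtree (2 * j) (T.cball p.1 j)) : T'.IsSubtree (2 * j) (T'.cball p'.1 j) := by
  obtain ⟨φ, -⟩ := h
  exact hT.isSubtree_of_iso hT' φ hp

lemma RootedIso.adj {j : ℕ} {p : V × V} {p' : V' × V'} (h : RootedIso T T' j p p')
    (hp : T.Adj p.1 p.2) : T'.Adj p'.1 p'.2 := by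
  obtain ⟨φ, hm, h1, h2⟩ := h
  rw [← h1, ← h2]
  exact (φ.map_adj_iff (v := ⟨p.1, self_mem_cball p.1 j⟩) (w := ⟨p.2, hm⟩)).mpr hp

/-- Puts the pairs of type `r` into the form required by `card_le_of_local`: each has its first
entry at the center of a maximal vine, namely of the ball itself. -/
lemma IsTree.setOf_rootedIso_eq [Finite V] [Finite V₀] (hT : T.IsTree) (hT₀ : T₀.IsTree) {j : ℕ}
    {r : V₀ × V₀} (hr : T₀.IsSubtree (2 * j) (T₀.cball r.1 j)) :
    {p | ∃ W, Maximal (T.IsSubtree (2 * j)) W ∧ p.1 ∈ W ∧ p.2 ∈ W ∧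
      (∀ s ∈ W, T.dist p.1 s ≤ j) ∧ RootedIso T T₀ j p r} = {p | RootedIso T T₀ j p r} := by
  ext p
  constructor
  · rintro ⟨W, -, -, -, -, h⟩
    exact h
  · intro h
    exact ⟨T.cball p.1 j,
      hT.maximal_cball (hT₀.isSubtree_cball_of_rootedIso hT (RootedIso.symm h) hr),
      self_mem_cball _ _, h.choose_spec.choose, fun _ hs => hs, h⟩

lemma IsTree.ncard_rootedIso_le [Finite V] [Finite V'] [Finite V₀] (hT : T.IsTree)
    (hT' : T'.IsTree) (hT₀ : T₀.IsTree) {j : ℕ} {r : V₀ × V₀}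
    (hr : T₀.IsSubtree (2 * j) (T₀.cball r.1 j))
    (e : {W // Maximal (T.IsSubtree (2 * j)) W} ≃ {W // Maximal (T'.IsSubtree (2 * j)) W})
    (he : ∀ W, Nonempty (T.induce W.1 ≃g T'.induce (e W).1)) :
    {p | RootedIso T T₀ j p r}.ncard ≤ {p | RootedIso T' T₀ j p r}.ncard := by
  rw [← hT.setOf_rootedIso_eq hT₀ hr, ← hT'.setOf_rootedIso_eq hT₀ hr]
  refine card_le_of_local e (fun W => (he W).some)
    (fun W p => p.1 ∈ W ∧ p.2 ∈ W ∧ (∀ s ∈ W, T.dist p.1 s ≤ j) ∧ RootedIso T T₀ j p r)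
    (fun W p => p.1 ∈ W ∧ p.2 ∈ W ∧ (∀ s ∈ W, T'.dist p.1 s ≤ j) ∧ RootedIso T' T₀ j p r)
    (fun _ _ h => ⟨h.1, h.2.1⟩) ?_ ?_
  · rintro W s t ⟨-, -, h1, h2⟩
    have hle : ∀ x ∈ (e W).1, T'.dist ((he W).some s : V') x ≤ j := fun x hx => by
      obtain ⟨y, hy⟩ := (he W).some.surjective ⟨x, hx⟩
      have := hT.dist_iso hT' (he W).some W.2.prop.convex s y
      rw [hy] at this
      exact this.trans_le (h1 y y.2)
    exact ⟨Subtype.coe_prop _, Subtype.coe_prop _, hle,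
      (hT.rootedIso_of_iso hT' (he W).some W.2.prop.convex s t
        (hT.eq_cball_of_maximal W.2 h1).ge (hT'.eq_cball_of_maximal (e W).2 hle).ge
        (h1 t t.2)).symm.trans h2⟩
  · rintro W₁ W₂ p h1 h2 ⟨-, -, h3, -⟩ ⟨-, -, h4, -⟩
    rw [hT'.eq_cball_of_maximal h1 h3, hT'.eq_cball_of_maximal h2 h4]

/-- An edge is the central edge of a maximal evine exactly when both its ends are vine centers; the
type `r` guarantees this for the first end. -/
lemma IsTree.setOf_rootedIso_adj_eq [Finite V] [Finite V₀] (hT : T.IsTree) (hT₀ : T₀.IsTree)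
    {j : ℕ} {r : V₀ × V₀} (hr : T₀.IsSubtree (2 * j) (T₀.cball r.1 j)) (hadj : T₀.Adj r.1 r.2) :
    {p | ∃ W, Maximal (T.IsSubtree (2 * j + 1)) W ∧ p.1 ∈ W ∧ p.2 ∈ W ∧ T.Adj p.1 p.2 ∧
      (∀ s ∈ W, T.dist p.1 s ≤ j ∨ T.dist p.2 s ≤ j) ∧ RootedIso T T₀ j p r} =
    {p | RootedIso T T₀ j p r} ∩ {p | T.IsSubtree (2 * j) (T.cball p.2 j)} := by
  ext p
  constructor
  · rintro ⟨W, hW, -, -, h1, h2, h⟩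
    exact ⟨h, (hT.eq_union_cball_of_maximal h1 hW h2).2.1⟩
  · rintro ⟨h, h'⟩
    have h1 := (RootedIso.symm h).adj hadj
    exact ⟨T.cball p.1 j ∪ T.cball p.2 j, hT.maximal_union_cball h1
      (hT₀.isSubtree_cball_of_rootedIso hT (RootedIso.symm h) hr) h',
      Or.inl (self_mem_cball _ _), Or.inr (self_mem_cball _ _), h1, fun _ hs => hs, h⟩

lemma IsTree.ncard_rootedIso_inter_le [Finite V] [Finite V'] [Finite V₀] (hT : T.IsTree)
    (hT' : T'.IsTree) (hT₀ : T₀.IsTree) {j : ℕ} (hj : 1 ≤ j) {r : V₀ × V₀}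
    (hr : T₀.IsSubtree (2 * j) (T₀.cball r.1 j)) (hadj : T₀.Adj r.1 r.2)
    (e : {W // Maximal (T.IsSubtree (2 * j + 1)) W} ≃ {W // Maximal (T'.IsSubtree (2 * j + 1)) W})
    (he : ∀ W, Nonempty (T.induce W.1 ≃g T'.induce (e W).1)) :
    ({p | RootedIso T T₀ j p r} ∩ {p | T.IsSubtree (2 * j) (T.cball p.2 j)}).ncard ≤
      ({p | RootedIso T' T₀ j p r} ∩ {p | T'.IsSubtree (2 * j) (T'.cball p.2 j)}).ncard := by
  rw [← hT.setOf_rootedIso_adj_eq hT₀ hr hadj, ← hT'.setOf_rootedIso_adj_eq hT₀ hr hadj]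
  refine card_le_of_local e (fun W => (he W).some)
    (fun W p => p.1 ∈ W ∧ p.2 ∈ W ∧ T.Adj p.1 p.2 ∧
      (∀ s ∈ W, T.dist p.1 s ≤ j ∨ T.dist p.2 s ≤ j) ∧ RootedIso T T₀ j p r)
    (fun W p => p.1 ∈ W ∧ p.2 ∈ W ∧ T'.Adj p.1 p.2 ∧
      (∀ s ∈ W, T'.dist p.1 s ≤ j ∨ T'.dist p.2 s ≤ j) ∧ RootedIso T' T₀ j p r)
    (fun _ _ h => ⟨h.1, h.2.1⟩) ?_ ?_
  · rintro W s t ⟨-, -, h0, h1, h2⟩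
    have hle : ∀ x ∈ (e W).1, T'.dist ((he W).some s : V') x ≤ j ∨
        T'.dist ((he W).some t : V') x ≤ j := fun x hx => by
      obtain ⟨y, hy⟩ := (he W).some.surjective ⟨x, hx⟩
      have e1 := hT.dist_iso hT' (he W).some W.2.prop.convex s y
      have e2 := hT.dist_iso hT' (he W).some W.2.prop.convex t y
      rw [hy] at e1 e2
      exact (h1 y y.2).imp e1.trans_le e2.trans_le
    have hadj' : T'.Adj ((he W).some s : V') ((he W).some t) :=
      ((he W).some.map_adj_iff (v := s) (w := t)).mpr h0
    exact ⟨Subtype.coe_prop _, Subtype.coe_prop _, hadj', hle,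
      (hT.rootedIso_of_iso hT' (he W).some W.2.prop.convex s t
        (Set.subset_union_left.trans (hT.eq_union_cball_of_maximal h0 W.2 h1).2.2.ge)
        (Set.subset_union_left.trans (hT'.eq_union_cball_of_maximal hadj' (e W).2 hle).2.2.ge)
        ((dist_eq_one_iff_adj.mpr h0).trans_le hj)).symm.trans h2⟩
  · rintro W₁ W₂ p h1 h2 ⟨-, -, h3, h4, -⟩ ⟨-, -, -, h5, -⟩
    rw [(hT'.eq_union_cball_of_maximal h3 h1 h4).2.2, (hT'.eq_union_cball_of_maximal h3 h2 h5).2.2]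

/-- An equivalence between the maximal subtrees of diameter `d` that preserves isomorphism types. -/
def MaximalEquiv (T : SimpleGraph V) (T' : SimpleGraph V') (d : ℕ) : Prop :=
  ∃ e : {W // Maximal (T.IsSubtree d) W} ≃ {W // Maximal (T'.IsSubtree d) W},
    ∀ W, Nonempty (T.induce W.1 ≃g T'.induce (e W).1)

lemma MaximalEquiv.symm {d : ℕ} (h : MaximalEquiv T T' d) : MaximalEquiv T' T d := by
  obtain ⟨e, he⟩ := h
  refine ⟨e.symm, fun W => ?_⟩
  obtain ⟨φ⟩ := he (e.symm W)
  rw [e.apply_symm_apply] at φ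
  exact ⟨φ.symm⟩

/-- The pair `p` is an edge whose first end is the center of a `j`-vine, whose second end is not,
and which starts a path of length `j`. -/
structure IsOutward (T : SimpleGraph V) (j : ℕ) (p : V × V) : Prop where
  adj : T.Adj p.1 p.2
  isSubtree : T.IsSubtree (2 * j) (T.cball p.1 j)
  not_isSubtree : ¬ T.IsSubtree (2 * j) (T.cball p.2 j)
  exists_dist : ∃ s, T.dist p.1 s = j ∧ T.dist p.2 s + 1 = j

lemma IsTree.exists_dist_of_rootedIso (hT : T.IsTree) (hT' : T'.IsTree) {j : ℕ} {p : V × V}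
    {p' : V' × V'} (h : RootedIso T T' j p p') (hp : ∃ s, T.dist p.1 s = j ∧ T.dist p.2 s + 1 = j) :
    ∃ s, T'.dist p'.1 s = j ∧ T'.dist p'.2 s + 1 = j := by
  obtain ⟨φ, hm, h1, h2⟩ := h
  obtain ⟨s, hs, hs'⟩ := hp
  have e1 := hT.dist_iso hT' φ (hT.geodConvex_cball _ _) ⟨p.1, self_mem_cball p.1 j⟩
    ⟨s, mem_cball.mpr hs.le⟩
  have e2 := hT.dist_iso hT' φ (hT.geodConvex_cball _ _) ⟨p.2, hm⟩ ⟨s, mem_cball.mpr hs.le⟩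
  rw [h1] at e1
  rw [h2] at e2
  exact ⟨_, e1.trans hs, by rw [e2, hs']⟩

/-- Vines count all pairs of type `r`, and evines count those whose second entry is a center. The
difference is positive in `T` because of `r` itself, and it is the same in `T'`. -/
lemma IsTree.exists_isOutward [Finite V] [Finite V'] (hT : T.IsTree) (hT' : T'.IsTree) {j : ℕ}
    (hj : 1 ≤ j) (hv : MaximalEquiv T T' (2 * j)) (he : MaximalEquiv T T' (2 * j + 1)) {r : V × V}
    (hr : T.IsOutward j r) : ∃ p, T'.IsOutward j p ∧ RootedIso T T' j r p := by
  have h1 : {p | RootedIso T T j p r}.ncard = {p | RootedIso T' T j p r}.ncard := by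
    obtain ⟨e, h⟩ := hv
    obtain ⟨e', h'⟩ := MaximalEquiv.symm ⟨e, h⟩
    exact le_antisymm (hT.ncard_rootedIso_le hT' hT hr.isSubtree e h)
      (hT'.ncard_rootedIso_le hT hT hr.isSubtree e' h')
  have h2 : ({p | RootedIso T T j p r} ∩ {p | T.IsSubtree (2 * j) (T.cball p.2 j)}).ncard =
      ({p | RootedIso T' T j p r} ∩ {p | T'.IsSubtree (2 * j) (T'.cball p.2 j)}).ncard := by
    obtain ⟨e, h⟩ := he
    obtain ⟨e', h'⟩ := MaximalEquiv.symm ⟨e, h⟩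
    exact le_antisymm (hT.ncard_rootedIso_inter_le hT' hT hj hr.isSubtree hr.adj e h)
      (hT'.ncard_rootedIso_inter_le hT hT hj hr.isSubtree hr.adj e' h')
  have h3 := Set.ncard_inter_add_ncard_sdiff_eq_ncard {p | RootedIso T T j p r}
    {p | T.IsSubtree (2 * j) (T.cball p.2 j)}
  have h4 := Set.ncard_inter_add_ncard_sdiff_eq_ncard {p | RootedIso T' T j p r}
    {p | T'.IsSubtree (2 * j) (T'.cball p.2 j)}
  have hrr : RootedIso T T j r r :=
    ⟨Iso.refl, (dist_eq_one_iff_adj.mpr hr.adj).trans_le hj, rfl, rfl⟩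
  have h5 : 0 < ({p | RootedIso T T j p r} \ {p | T.IsSubtree (2 * j) (T.cball p.2 j)}).ncard :=
    (Set.ncard_pos (Set.toFinite _)).mpr ⟨r, hrr, hr.not_isSubtree⟩
  obtain ⟨p, hp, hp'⟩ := (Set.ncard_pos (Set.toFinite _)).mp
    (by omega : 0 < ({p | RootedIso T' T j p r} \
      {p | T'.IsSubtree (2 * j) (T'.cball p.2 j)}).ncard)
  have hrp : RootedIso T T' j r p := RootedIso.symm hp
  exact ⟨p, ⟨hrp.adj hr.adj, hT.isSubtree_cball_of_rootedIso hT' hrp hr.isSubtree, hp',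
    hT.exists_dist_of_rootedIso hT' hrp hr.exists_dist⟩, hrp⟩

end RootedIso

end SimpleGraph

namespace SimpleGraph

/-! ### Vine centers along a longest path -/

section Spine

variable {V : Type*} {T : SimpleGraph V}

/-- A tree of diameter at least `2j+3` without a spider with three legs of length `j`, and the two
ends `a`, `b` of a longest path in it. -/
structure IsSpine (T : SimpleGraph V) (j : ℕ) (a b : V) : Prop where
  isTree : T.IsTree
  pos : 1 ≤ j
  not_spider : ¬ ContainsThreeSpider T j
  le : ∀ c d, T.dist c d ≤ T.dist a b
  long : 2 * j + 3 ≤ T.dist a b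

lemma IsSpine.symm {j : ℕ} {a b : V} (h : T.IsSpine j a b) : T.IsSpine j b a := by
  obtain ⟨h1, h2, h3, h4, h5⟩ := h
  exact ⟨h1, h2, h3, dist_comm (G := T) (u := a) ▸ h4, dist_comm (G := T) (u := a) ▸ h5⟩

lemma IsTree.dist_between (hT : T.IsTree) {a b c d : V}
    (hc : T.dist a c + T.dist c b = T.dist a b) (hd : T.dist a d + T.dist d b = T.dist a b)
    (h : T.dist a c ≤ T.dist a d) : T.dist a c + T.dist c d = T.dist a d := by
  have e := T.dist_comm (u := c) (v := d)
  rcases hT.dist_or hc d with h1 | h1 <;> omega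

lemma IsTree.containsThreeSpider_of_three (hT : T.IsTree) {j : ℕ} {c p q r : V}
    (hp : j ≤ T.dist c p) (hq : j ≤ T.dist c q) (hr : j ≤ T.dist c r)
    (hpq : T.dist p c + T.dist c q = T.dist p q) (hpr : T.dist p c + T.dist c r = T.dist p r)
    (hqr : T.dist q c + T.dist c r = T.dist q r) : ContainsThreeSpider T j := by
  have e1 := T.dist_comm (u := p) (v := c)
  have e2 := T.dist_comm (u := q) (v := c)
  have e3 := T.dist_comm (u := r) (v := c)
  have e4 := T.dist_comm (u := p) (v := q)
  have e5 := T.dist_comm (u := p) (v := r)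
  have e6 := T.dist_comm (u := q) (v := r)
  refine hT.containsThreeSpider_of_dist (c := c) (p := ![p, q, r]) (fun i => ?_)
    (fun i l hil => ?_)
  · fin_cases i <;> simpa
  · fin_cases i <;> fin_cases l <;> first | exact absurd rfl hil | (simp; omega)

/-- If `c` were off the path, the vine would reach further than `j` from the median `m`, away from
the path. As the path is longest, both its ends are then at least as far from `m`, which gives a
spider at `m`. -/
lemma IsSpine.between_of_isSubtree {j : ℕ} {a b c : V} (h : T.IsSpine j a b)
    (hc : T.IsSubtree (2 * j) (T.cball c j)) :
    T.dist a c + T.dist c b = T.dist a b ∧ j ≤ T.dist a c ∧ j ≤ T.dist c b := by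
  have hT := h.isTree
  obtain ⟨m, h1, h2, h3⟩ := hT.exists_median a b c
  have hcm : c = m := by
    by_contra hne
    have hpos := hT.connected.pos_dist_of_ne hne
    obtain ⟨p, hp, hp'⟩ := hT.exists_dist_eq_add hc m
    refine h.not_spider (hT.containsThreeSpider_of_three (c := m) (p := a) (q := b) (r := p)
      ?_ ?_ ?_ h1 ?_ ?_)
    all_goals
      have e1 := T.dist_comm (u := a) (v := m)
      have e2 := T.dist_comm (u := b) (v := m)
      have e3 := T.dist_comm (u := c) (v := m)
      have e4 := T.dist_comm (u := p) (v := m)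
      have e5 := T.dist_comm (u := a) (v := p)
      have e6 := T.dist_comm (u := b) (v := p)
      have e7 := T.dist_comm (u := c) (v := p)
      have e8 := T.dist_comm (u := c) (v := b)
      have l1 := h.le a p
      have l2 := h.le p b
      have ha := hT.dist_or (a := a) (b := c) (c := m) (by omega) p
      have hb := hT.dist_or (a := b) (b := c) (c := m) (by omega) p
      omega
  subst hcm
  refine ⟨h1, ?_, ?_⟩
  · obtain ⟨p, hp, hp'⟩ := hT.exists_dist_eq_add hc b
    have := h.le b p
    have e := T.dist_comm (u := c) (v := b)
    omega
  · obtain ⟨p, hp, hp'⟩ := hT.exists_dist_eq_add hc a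
    have := h.le a p
    omega

lemma IsSpine.isSubtree_of_between {j : ℕ} {a b c : V} (h : T.IsSpine j a b)
    (hc : T.dist a c + T.dist c b = T.dist a b) (ha : j ≤ T.dist a c) (hb : j ≤ T.dist c b) :
    T.IsSubtree (2 * j) (T.cball c j) := by
  have hT := h.isTree
  rw [dist_comm] at ha
  obtain ⟨p, hp, hp'⟩ := hT.exists_dist_eq ha
  obtain ⟨q, hq, hq'⟩ := hT.exists_dist_eq hb
  have e1 := T.dist_comm (u := a) (v := p)
  have e2 := T.dist_comm (u := a) (v := c)
  have e3 := T.dist_comm (u := c) (v := p)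
  have h1 := hT.connected.dist_triangle (u := a) (v := p) (w := b)
  have h2 := hT.connected.dist_triangle (u := p) (v := q) (w := b)
  have h3 := hT.connected.dist_triangle (u := p) (v := c) (w := q)
  exact hT.isSubtree_cball (a := p) (b := q) (by omega) (by omega) (by omega)

/-- At a center of a `j`-vine, the paths of length `j` start along the longest path. -/
lemma IsSpine.between_of_adj {j : ℕ} {a b c u : V} (h : T.IsSpine j a b)
    (hc : T.dist a c + T.dist c b = T.dist a b) (ha : j ≤ T.dist a c) (hb : j ≤ T.dist c b)
    (hadj : T.Adj c u) (hu : ∃ s, T.dist c s = j ∧ T.dist u s + 1 = j) :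
    T.dist a u + T.dist u b = T.dist a b := by
  have hT := h.isTree
  have hcu : T.dist c u = 1 := dist_eq_one_iff_adj.mpr hadj
  obtain ⟨s, hs, hs'⟩ := hu
  -- If `u` leaves the path, then `c` separates `a`, `b` and `s` and is the branch vertex of a
  -- spider.
  by_contra hne
  have e1 := T.dist_comm (u := u) (v := c)
  have e2 := T.dist_comm (u := c) (v := a)
  have e3 := T.dist_comm (u := u) (v := a)
  have e4 := T.dist_comm (u := u) (v := b)
  have e5 := T.dist_comm (u := c) (v := b)
  have e6 := T.dist_comm (u := c) (v := s)
  have e7 := T.dist_comm (u := a) (v := s)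
  have e8 := T.dist_comm (u := b) (v := s)
  have h1 := hT.dist_eq_dist_add_one_of_adj a hadj
  have h2 := hT.dist_eq_dist_add_one_of_adj b hadj
  have h3 := hT.connected.dist_triangle (u := a) (v := u) (w := b)
  have h4 := hT.dist_or (a := u) (b := a) (c := c) (by omega) s
  have h5 := hT.dist_or (a := u) (b := b) (c := c) (by omega) s
  exact h.not_spider (hT.containsThreeSpider_of_three (c := c) (p := a) (q := b) (r := s)
    (by omega) (by omega) (by omega) hc (by omega) (by omega))

/-- The vertex `x` is at distance `j` from the end `a` of a longest path from `a` to `b`; its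
neighbors on this path are `o`, towards `a`, and `t`, towards `b`. -/
structure IsEnd (T : SimpleGraph V) (j : ℕ) (a b x o t : V) : Prop where
  isSpine : T.IsSpine j a b
  dist_ax : T.dist a x = j
  dist_xb : T.dist x b + j = T.dist a b
  dist_ao : T.dist a o + 1 = j
  dist_ob : T.dist o b + j = T.dist a b + 1
  dist_at : T.dist a t = j + 1
  dist_tb : T.dist t b + j + 1 = T.dist a b

variable {j : ℕ} {a b x o t : V}

lemma IsEnd.adj_out (h : T.IsEnd j a b x o t) : T.Adj x o := by
  obtain ⟨h0, h1, h2, h3, h4, h5, h6⟩ := h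
  rw [← dist_eq_one_iff_adj, dist_comm]
  have := h0.isTree.dist_between (a := a) (b := b) (c := o) (d := x) (by omega) (by omega) (by omega)
  omega

lemma IsEnd.adj_trunk (h : T.IsEnd j a b x o t) : T.Adj x t := by
  obtain ⟨h0, h1, h2, h3, h4, h5, h6⟩ := h
  rw [← dist_eq_one_iff_adj]
  have := h0.isTree.dist_between (a := a) (b := b) (c := x) (d := t) (by omega) (by omega) (by omega)
  omega

lemma IsEnd.isSubtree (h : T.IsEnd j a b x o t) : T.IsSubtree (2 * j) (T.cball x j) := by
  obtain ⟨h0, h1, h2, h3, h4, h5, h6⟩ := h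
  have := h0.long
  exact h0.isSubtree_of_between (by omega) (by omega) (by omega)

lemma IsEnd.exists_dist_out (h : T.IsEnd j a b x o t) :
    ∃ s, T.dist x s = j ∧ T.dist o s + 1 = j := by
  refine ⟨a, ?_, ?_⟩ <;> rw [dist_comm]
  exacts [h.dist_ax, h.dist_ao]

lemma IsEnd.exists_dist_trunk (h : T.IsEnd j a b x o t) :
    ∃ s, T.dist x s = j ∧ T.dist t s + 1 = j := by
  have hxt := dist_eq_one_iff_adj.mpr h.adj_trunk
  obtain ⟨h0, h1, h2, h3, h4, h5, h6⟩ := h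
  have := h0.long
  have := h0.pos
  obtain ⟨s, hs, hs'⟩ := h0.isTree.exists_dist_eq (a := t) (b := b) (i := j - 1) (by omega)
  have h7 := h0.isTree.connected.dist_triangle (u := x) (v := s) (w := b)
  have h8 := h0.isTree.connected.dist_triangle (u := x) (v := t) (w := s)
  exact ⟨s, by omega, by omega⟩

lemma IsEnd.isOutward (h : T.IsEnd j a b x o t) : T.IsOutward j (x, o) :=
  ⟨h.adj_out, h.isSubtree, fun hs => by
    have := (h.isSpine.between_of_isSubtree hs).2.1
    have := h.dist_ao
    simp only at *
    omega, h.exists_dist_out⟩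

lemma IsEnd.out_ne_trunk (h : T.IsEnd j a b x o t) : o ≠ t := by
  rintro rfl
  have h1 := h.dist_ao
  have h2 := h.dist_at
  omega

/-- The major directions at an end center are `o` and `t`. -/
lemma IsEnd.eq_or_eq (h : T.IsEnd j a b x o t) {v : V} (hv : T.Adj x v)
    (hs : ∃ s, T.dist x s = j ∧ T.dist v s + 1 = j) : v = o ∨ v = t := by
  obtain ⟨h0, h1, h2, h3, h4, h5, h6⟩ := h
  have hT := h0.isTree
  have hl := h0.long
  have hbtw := h0.between_of_adj (by omega) (by omega) (by omega) hv hs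
  rcases hT.dist_eq_dist_add_one_of_adj a hv with h7 | h7
  · exact Or.inl (hT.eq_of_dist_eq hbtw (by omega) (by omega))
  · exact Or.inr (hT.eq_of_dist_eq hbtw (by omega) (by omega))

/-- The outward pairs are the two at the ends of the longest path. -/
lemma IsOutward.eq_or_eq {y o' t' : V} {p : V × V} (hp : T.IsOutward j p)
    (h : T.IsEnd j a b x o t) (h' : T.IsEnd j b a y o' t') : p = (x, o) ∨ p = (y, o') := by
  obtain ⟨c, u⟩ := p
  obtain ⟨hadj, hc, hu, hs⟩ := hp
  simp only at hadj hc hu hs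
  obtain ⟨h0, h1, h2, h3, h4, h5, h6⟩ := h
  obtain ⟨-, h1', h2', h3', h4', h5', h6'⟩ := h'
  have hT := h0.isTree
  obtain ⟨hb, hb1, hb2⟩ := h0.between_of_isSubtree hc
  have hub := h0.between_of_adj hb hb1 hb2 hadj hs
  -- Both `c` and `u` are on the longest path; only `c` has distance at least `j` from both ends, so
  -- `c` is at distance exactly `j` from one of them.
  have hnot : ¬ (j ≤ T.dist a u ∧ j ≤ T.dist u b) := fun hh =>
    hu (h0.isSubtree_of_between hub hh.1 hh.2)
  have hyb : T.dist y b = j := by rw [dist_comm, h1']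
  have hya : T.dist a y + j = T.dist a b := by rw [T.dist_comm (u := a) (v := y), h2', dist_comm]
  have hob : T.dist o' b + 1 = j := by rw [dist_comm, h3']
  have hoa : T.dist a o' + j = T.dist a b + 1 := by
    rw [T.dist_comm (u := a) (v := o'), h4', T.dist_comm (u := a) (v := b)]
  have e1 := hT.dist_eq_dist_add_one_of_adj a hadj
  clear h1' h2' h3' h4' h5' h6' h5 h6
  by_cases hau : j ≤ T.dist a u
  · right
    have hub' : T.dist u b + 1 ≤ j := Nat.lt_of_not_le fun hh => hnot ⟨hau, hh⟩
    clear hnot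
    have hac : T.dist a c = T.dist a y := by omega
    have hau' : T.dist a u = T.dist a o' := by omega
    rw [hT.eq_of_dist_eq (c := c) (c' := y) hb (by omega) hac,
      hT.eq_of_dist_eq (c := u) (c' := o') hub (by omega) hau']
  · left
    clear hnot
    have hac : T.dist a c = T.dist a x := by omega
    have hau' : T.dist a u = T.dist a o := by omega
    rw [hT.eq_of_dist_eq (c := c) (c' := x) hb (by omega) hac,
      hT.eq_of_dist_eq (c := u) (c' := o) hub (by omega) hau']

end Spine

/-! ### Major pieces as major directions -/

section MajorPieces

variable {V : Type*} {T : SimpleGraph V} {j : ℕ}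

/-- If `v` is not on the way from `x` to `w`, then `x` separates them. If it is, the path from `v`
to `w` avoids `x` and stays in the ball. -/
lemma IsTree.reachable_induce_iff (hT : T.IsTree) {x : V} {v w : ↥(T.cball x j \ {x})}
    (hv : T.Adj x v) : (T.induce (T.cball x j \ {x})).Reachable v w ↔
      T.dist (v : V) w + 1 = T.dist x w := by
  have hxv : T.dist x v = 1 := dist_eq_one_iff_adj.mpr hv
  have hvx : T.dist (v : V) x = 1 := dist_eq_one_iff_adj.mpr hv.symm
  constructor
  · rintro ⟨p⟩
    have h1 := hT.dist_eq_dist_add_one_of_adj (w : V) hv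
    rw [T.dist_comm (v := x), T.dist_comm (v := (v : V))] at h1
    by_contra hne
    have := hT.mem_support_of_dist (a := (Embedding.induce (T.cball x j \ {x})).toHom v)
      (b := (Embedding.induce (T.cball x j \ {x})).toHom w) (c := x)
      (by change T.dist (v : V) x + T.dist x w = T.dist (v : V) w; omega)
      (p.map (Embedding.induce (T.cball x j \ {x})).toHom)
    rw [Walk.support_map, List.mem_map] at this
    obtain ⟨y, -, hy⟩ := this
    exact y.2.2 hy
  · intro h
    obtain ⟨p, hp, hl⟩ := hT.connected.exists_path_of_dist (v : V) w
    have hw : T.dist x w ≤ j := w.2.1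
    refine ⟨p.induce _ fun y hy => ?_⟩
    have h1 := hT.dist_of_mem_support hp hy
    have h2 := hT.connected.dist_triangle (u := x) (v := (v : V)) (w := y)
    refine ⟨by rw [mem_cball]; omega, ?_⟩
    rintro rfl
    omega

lemma IsTree.mem_majorPieces_cball_iff (hT : T.IsTree) (hj : 1 ≤ j) {x : V} {M : Set V} :
    M ∈ majorPieces T j (T.cball x j) x ↔ ∃ v, T.Adj x v ∧
      (∃ s, T.dist x s = j ∧ T.dist v s + 1 = j) ∧
      M = {w | T.dist x w ≤ j ∧ T.dist v w + 1 = T.dist x w} := by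
  have hset : ∀ v : ↥(T.cball x j \ {x}), T.Adj x v → Subtype.val ''
      {w : ↥(T.cball x j \ {x}) | (T.induce (T.cball x j \ {x})).Reachable v w} =
      {w | T.dist x w ≤ j ∧ T.dist (v : V) w + 1 = T.dist x w} := by
    intro v hv
    ext w
    constructor
    · rintro ⟨w, hw, rfl⟩
      exact ⟨w.2.1, (hT.reachable_induce_iff hv).mp hw⟩
    · rintro ⟨h1, h2⟩
      refine ⟨⟨w, h1, ?_⟩, (hT.reachable_induce_iff hv).mpr h2, rfl⟩
      rintro rfl
      rw [dist_self] at h2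
      omega
  constructor
  · rintro ⟨v, hv, ⟨w, p, hp, hl⟩, rfl⟩
    refine ⟨v, hv, ⟨w, ?_⟩, hset v hv⟩
    have h1 := (hT.reachable_induce_iff hv).mp p.reachable
    have h2 : (p.map (Embedding.induce _).toHom).IsPath :=
      hp.map (f := (Embedding.induce (G := T) _).toHom) (Embedding.induce (G := T) _).injective
    have h3 := hT.length_eq_dist h2
    rw [Walk.length_map] at h3
    rw [Walk.length_support] at hl
    have h4 : T.dist (v : V) w = p.length := h3.symm
    omega
  · rintro ⟨v, hv, ⟨s, hs, hs'⟩, rfl⟩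
    have hxv : T.dist x v = 1 := dist_eq_one_iff_adj.mpr hv
    let v' : ↥(T.cball x j \ {x}) := ⟨v, by rw [mem_cball]; omega, hv.ne'⟩
    have hsx : s ≠ x := by
      rintro rfl
      rw [dist_self] at hs
      omega
    let s' : ↥(T.cball x j \ {x}) := ⟨s, hs.le, hsx⟩
    refine ⟨v', hv, ⟨s', ?_⟩, (hset v' hv).symm⟩
    obtain ⟨p, hp⟩ := ((hT.reachable_induce_iff (v := v') (w := s') hv).mpr (by
      change T.dist v s + 1 = T.dist x s
      omega)).exists_isPath
    refine ⟨p, hp, ?_⟩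
    have h2 : (p.map (Embedding.induce _).toHom).IsPath :=
      hp.map (f := (Embedding.induce (G := T) _).toHom) (Embedding.induce (G := T) _).injective
    have h3 := hT.length_eq_dist h2
    rw [Walk.length_map] at h3
    have h4 : T.dist v s = p.length := h3.symm
    rw [Walk.length_support]
    omega

lemma IsEnd.majorPieces_eq {a b x o t : V} (h : T.IsEnd j a b x o t) :
    majorPieces T j (T.cball x j) x = {{w | T.dist x w ≤ j ∧ T.dist o w + 1 = T.dist x w},
      {w | T.dist x w ≤ j ∧ T.dist t w + 1 = T.dist x w}} := by
  ext M
  rw [h.isSpine.isTree.mem_majorPieces_cball_iff h.isSpine.pos, Set.mem_insert_iff,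
    Set.mem_singleton_iff]
  constructor
  · rintro ⟨v, hv, hs, rfl⟩
    rcases h.eq_or_eq hv hs with rfl | rfl
    exacts [Or.inl rfl, Or.inr rfl]
  · rintro (rfl | rfl)
    exacts [⟨o, h.adj_out, h.exists_dist_out, rfl⟩, ⟨t, h.adj_trunk, h.exists_dist_trunk, rfl⟩]

lemma IsEnd.trunk_mem {a b x o t : V} (h : T.IsEnd j a b x o t) :
    t ∈ {w | T.dist x w ≤ j ∧ T.dist t w + 1 = T.dist x w} := by
  have hxt := dist_eq_one_iff_adj.mpr h.adj_trunk
  have := h.isSpine.pos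
  rw [Set.mem_ofPred_eq, dist_self]
  omega

lemma IsEnd.ncard_majorPieces {a b x o t : V} (h : T.IsEnd j a b x o t) :
    (majorPieces T j (T.cball x j) x).ncard = 2 := by
  rw [h.majorPieces_eq, Set.ncard_pair]
  intro heq
  have h1 := h.trunk_mem
  rw [← heq] at h1
  obtain ⟨-, h1⟩ := h1
  have hxt := dist_eq_one_iff_adj.mpr h.adj_trunk
  exact h.out_ne_trunk (h.isSpine.isTree.connected.dist_eq_zero_iff.mp (by omega))

end MajorPieces

end SimpleGraph

namespace SimpleGraph

/-! ### Graph centers of vines -/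

section Center

variable {V : Type*} {T : SimpleGraph V}

lemma IsTree.edist_induce (hT : T.IsTree) {S : Set V} (hS : T.GeodConvex S) (a b : S) :
    (T.induce S).edist a b = T.dist (a : V) b := by
  obtain ⟨p, -⟩ := hT.exists_walk_induce hS a b
  rw [← p.reachable.coe_dist_eq_edist, hT.dist_induce hS]

/-- The radius is `j`: the midpoint of a diametral path attains it, and every vertex is at distance
at least `j` from one end of that path. -/
lemma IsTree.mem_center_induce_iff (hT : T.IsTree) {j : ℕ} {U : Set V}
    (hU : T.IsSubtree (2 * j) U) {x : U} :
    x ∈ (T.induce U).center ↔ ∀ s ∈ U, T.dist (x : V) s ≤ j := by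
  have hecc : ∀ y : U, (T.induce U).eccent y ≤ j ↔ ∀ s ∈ U, T.dist (y : V) s ≤ j := fun y => by
    rw [eccent_le_iff]
    refine ⟨fun h s hs => ?_, fun h s => ?_⟩
    · have := h ⟨s, hs⟩
      rw [hT.edist_induce hU.convex] at this
      exact_mod_cast this
    · rw [hT.edist_induce hU.convex]
      exact_mod_cast h s s.2
  obtain ⟨a, ha, b, hb, hab⟩ := hU.exists_eq
  rw [mem_center_iff, ← hecc]
  constructor
  · intro h
    obtain ⟨c, hc, hc'⟩ := hT.exists_dist_eq (a := a) (b := b) (i := j) (by omega)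
    rw [h]
    exact (radius_le_eccent (u := ⟨c, hU.convex a ha b hb c (by omega)⟩)).trans
      ((hecc _).mpr fun s hs => hT.dist_le_of_midpoint hU.le ha hb hc (by omega) hab hs)
  · intro h
    refine le_antisymm (h.trans (le_iInf fun y => ?_)) radius_le_eccent
    have h1 := hT.connected.dist_triangle (u := a) (v := (y : V)) (w := b)
    have h2 := T.dist_comm (u := a) (v := (y : V))
    rcases le_or_gt j (T.dist (y : V) a) with h3 | h3
    · have h4 := (T.induce U).edist_le_eccent (u := y) (v := ⟨a, ha⟩)
      rw [hT.edist_induce hU.convex] at h4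
      exact le_trans (by exact_mod_cast h3) h4
    · have h4 := (T.induce U).edist_le_eccent (u := y) (v := ⟨b, hb⟩)
      rw [hT.edist_induce hU.convex] at h4
      exact le_trans (by exact_mod_cast (by omega : j ≤ T.dist (y : V) b)) h4

end Center

/-! ### Longest paths and their common end centers -/

section LongestPaths

variable {V : Type*} {T : SimpleGraph V}

lemma IsTree.dist_getVert (hT : T.IsTree) {a b : V} {p : T.Walk a b} (hp : p.IsPath) {i : ℕ}
    (hi : i ≤ T.dist a b) :
    T.dist a (p.getVert i) = i ∧ T.dist (p.getVert i) b + i = T.dist a b := by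
  have hl := hT.length_eq_dist hp
  have h1 : T.dist a (p.getVert i) ≤ i := (dist_le (p.take i)).trans (by simp)
  have h2 : T.dist (p.getVert i) b ≤ T.dist a b - i := (dist_le (p.drop i)).trans (by simp [hl])
  have h3 := hT.connected.dist_triangle (u := a) (v := p.getVert i) (w := b)
  omega

lemma IsTree.exists_dist_max [Finite V] (hT : T.IsTree) :
    ∃ a b, ∀ c d, T.dist c d ≤ T.dist a b := by
  have := hT.connected.nonempty
  obtain ⟨⟨a, b⟩, h⟩ := Finite.exists_max fun p : V × V => T.dist p.1 p.2
  exact ⟨a, b, fun c d => h (c, d)⟩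

lemma IsTree.isLongestPath_iff (hT : T.IsTree) {a b : V} {p : T.Walk a b} (hp : p.IsPath) :
    IsLongestPath T p ↔ ∀ c d, T.dist c d ≤ T.dist a b := by
  constructor
  · intro h c d
    obtain ⟨q, hq, hl⟩ := hT.connected.exists_path_of_dist c d
    rw [← hl, ← hT.length_eq_dist hp]
    exact h.2 c d q hq
  · intro h
    refine ⟨hp, fun c d q hq => ?_⟩
    rw [hT.length_eq_dist hp, hT.length_eq_dist hq]
    exact h c d

variable {j : ℕ} {a b x y t : V}

lemma IsSpine.exists_isEnd (h : T.IsSpine j a b) (hx : T.dist a x = j)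
    (hx' : T.dist x b + j = T.dist a b) (hy : T.dist b y = j) (hy' : T.dist y a + j = T.dist b a)
    (hadj : T.Adj x t) (ht : T.dist x t + T.dist t y = T.dist x y) :
    ∃ o, T.IsEnd j a b x o t := by
  have hT := h.isTree
  have hl := h.long
  have hpos := h.pos
  have hxt : T.dist x t = 1 := dist_eq_one_iff_adj.mpr hadj
  rw [T.dist_comm (u := b)] at hy
  rw [T.dist_comm (u := y), T.dist_comm (u := b)] at hy'
  have h1 := hT.dist_between (a := a) (b := b) (c := x) (d := y) (by omega) (by omega) (by omega)
  have h2 := hT.connected.dist_triangle (u := a) (v := x) (w := t)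
  have h3 := hT.connected.dist_triangle (u := t) (v := y) (w := b)
  have h4 := hT.connected.dist_triangle (u := a) (v := t) (w := b)
  obtain ⟨o, ho, ho'⟩ := hT.exists_dist_eq (a := a) (b := b) (i := j - 1) (by omega)
  exact ⟨o, h, hx, hx', by omega, by omega, by omega, by omega⟩

/-- Every longest path has the same two vertices at distance `j` from its ends. -/
lemma IsSpine.ends_eq {a' b' x' y' : V} (h : T.IsSpine j a b) (h' : T.IsSpine j a' b')
    (hx : T.dist a x = j) (hx' : T.dist x b + j = T.dist a b)
    (hy : T.dist b y = j) (hy' : T.dist y a + j = T.dist b a)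
    (hz : T.dist a' x' = j) (hz' : T.dist x' b' + j = T.dist a' b')
    (hw : T.dist b' y' = j) (hw' : T.dist y' a' + j = T.dist b' a') :
    (x = x' ∧ y = y') ∨ (y = x' ∧ x = y') := by
  have hT := h.isTree
  have hl := h.long
  have hD : T.dist a b = T.dist a' b' := le_antisymm (h'.le a b) (h.le a' b')
  rw [T.dist_comm (u := b)] at hy
  rw [T.dist_comm (u := y), T.dist_comm (u := b)] at hy'
  rw [T.dist_comm (u := b')] at hw
  rw [T.dist_comm (u := y'), T.dist_comm (u := b')] at hw'
  have h1 := hT.dist_between (a := a') (b := b') (c := x') (d := y') (by omega) (by omega) (by omega)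
  -- As vine centers, `x'` and `y'` lie on the first path at distance at least `j` from its ends.
  -- Their mutual distance leaves only the two extreme positions.
  obtain ⟨h2, h3, h4⟩ := h.between_of_isSubtree
    (h'.isSubtree_of_between (c := x') (by omega) (by omega) (by omega))
  obtain ⟨h5, h6, h7⟩ := h.between_of_isSubtree
    (h'.isSubtree_of_between (c := y') (by omega) (by omega) (by omega))
  rcases le_total (T.dist a x') (T.dist a y') with h8 | h8
  · have h9 := hT.dist_between h2 h5 h8
    exact Or.inl ⟨hT.eq_of_dist_eq (a := a) (b := b) (by omega) (by omega) (by omega),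
      hT.eq_of_dist_eq (a := a) (b := b) (by omega) (by omega) (by omega)⟩
  · have h9 := hT.dist_between h5 h2 h8
    rw [T.dist_comm (u := y')] at h9
    exact Or.inr ⟨hT.eq_of_dist_eq (a := a) (b := b) (by omega) (by omega) (by omega),
      hT.eq_of_dist_eq (a := a) (b := b) (by omega) (by omega) (by omega)⟩

end LongestPaths

/-! ### Existence and shape of the end vines -/

section EndVines

variable {V : Type*} {T : SimpleGraph V} {k : ℕ}

lemma IsTree.isVine_eq [Finite V] (hT : T.IsTree) (j : ℕ) : IsVine T j = T.IsSubtree (2 * j) :=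
  funext fun _ => propext hT.isSubtree_iff

lemma IsTree.exists_isEndVines [Finite V] (hT : T.IsTree) (hk : 2 ≤ k)
    (hd : ∃ a b, 2 * k + 1 ≤ T.dist a b) (hS : ¬ ContainsThreeSpider T (k - 1)) :
    ∃ U x t, IsEndVines T k U x t := by
  obtain ⟨a, b, hmax⟩ := hT.exists_dist_max
  obtain ⟨c, d, hcd⟩ := hd
  -- Since `k ≥ 2`, this is `2k+1` expressed in `j = k-1`. It keeps the two centers at least three
  -- apart, so the trunk exists.
  have hlong : 2 * (k - 1) + 3 ≤ T.dist a b := by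
    have := hmax c d
    omega
  have hspine : T.IsSpine (k - 1) a b := ⟨hT, by omega, hS, hmax, hlong⟩
  obtain ⟨x, hx, hxb⟩ := hT.exists_dist_eq (a := a) (b := b) (i := k - 1) (by omega)
  obtain ⟨y, hy, hya⟩ := hT.exists_dist_eq (a := b) (b := a) (i := k - 1)
    (by rw [dist_comm]; omega)
  have e1 := T.dist_comm (u := a) (v := b)
  have e2 := T.dist_comm (u := b) (v := y)
  have e3 := T.dist_comm (u := y) (v := a)
  have e4 := T.dist_comm (u := x) (v := y)
  have hxy := hT.dist_between (a := a) (b := b) (c := x) (d := y)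
    (by omega) (by omega) (by omega)
  have hvx : T.IsSubtree (2 * (k - 1)) (T.cball x (k - 1)) :=
    hspine.isSubtree_of_between (by omega) (by omega) (by omega)
  have hvy : T.IsSubtree (2 * (k - 1)) (T.cball y (k - 1)) :=
    hspine.isSubtree_of_between (by omega) (by omega) (by omega)
  have htrunk : ∀ u v : V, T.dist u v ≠ 0 → ∃ t ∈ T.cball u (k - 1),
      ∃ q : T.Walk u v, q.IsPath ∧ s(u, t) ∈ q.edges := by
    intro u v huv
    obtain ⟨t, ht, htv⟩ := hT.exists_dist_eq (a := u) (b := v) (i := 1) (by omega)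
    obtain ⟨q, hq⟩ := hT.connected.exists_walk_length_eq_dist t v
    refine ⟨t, by rw [mem_cball]; omega, Walk.cons (dist_eq_one_iff_adj.mp ht) q,
      Walk.isPath_of_length_eq_dist _ (by rw [Walk.length_cons]; omega), by simp⟩
  obtain ⟨t, ht, ht'⟩ := htrunk x y (by omega)
  obtain ⟨t₂, ht₂, ht₂'⟩ := htrunk y x (by omega)
  refine ⟨![T.cball x (k - 1), T.cball y (k - 1)], ![x, y], ![t, t₂], ?_, ?_, ?_, ?_, ?_⟩
  · rw [hT.isVine_eq]
    exact Fin.forall_fin_two.mpr ⟨hT.maximal_cball hvx, hT.maximal_cball hvy⟩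
  · exact Fin.forall_fin_two.mpr
      ⟨⟨self_mem_cball _ _, (hT.mem_center_induce_iff hvx).mpr fun s hs => hs⟩,
        ⟨self_mem_cball _ _, (hT.mem_center_induce_iff hvy).mpr fun s hs => hs⟩⟩
  · change x ≠ y
    rintro rfl
    rw [dist_self] at hxy
    omega
  · intro a' b' p hp
    have hmax' := (hT.isLongestPath_iff hp.1).mp hp
    have hD : T.dist a b ≤ T.dist a' b' := hmax' a b
    have e5 := T.dist_comm (u := a') (v := b')
    obtain ⟨h1, h2⟩ := hT.dist_getVert hp.1 (i := k - 1) (by omega)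
    obtain ⟨h3, h4⟩ := hT.dist_getVert hp.1.reverse (i := k - 1) (by omega)
    have hxb' : T.dist x b + (k - 1) = T.dist a b := by omega
    have hya' : T.dist y a + (k - 1) = T.dist b a := by omega
    exact hspine.ends_eq ⟨hT, by omega, hS, hmax', by omega⟩ hx hxb' hy hya' h1 h2 h3 h4
  · exact Fin.forall_fin_two.mpr ⟨⟨ht, ht'⟩, ⟨ht₂, ht₂'⟩⟩

/-- Converts arbitrary end-vine data into metric form: balls, with one outward neighbor `o i`
opposite to each trunk edge, and no further outward edges in the tree. -/
lemma IsTree.isEndVines_spec [Finite V] (hT : T.IsTree) (hk : 2 ≤ k)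
    (hd : ∃ a b, 2 * k + 1 ≤ T.dist a b) (hS : ¬ ContainsThreeSpider T (k - 1))
    {U : Fin 2 → Set V} {x t : Fin 2 → V} (h : IsEndVines T k U x t) :
    (∀ i, U i = T.cball (x i) (k - 1)) ∧ ∃ o : Fin 2 → V,
      (∀ i, ∃ a b, T.IsEnd (k - 1) a b (x i) (o i) (t i)) ∧
      ∀ p, T.IsOutward (k - 1) p → ∃ i, p = (x i, o i) := by
  have htr : ∀ i, T.Adj (x i) (t i) ∧
      T.dist (x i) (t i) + T.dist (t i) (x i.rev) = T.dist (x i) (x i.rev) := by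
    intro i
    obtain ⟨-, q, hq, he⟩ := h.trunk i
    exact ⟨q.adj_of_mem_edges he, hT.dist_of_mem_support hq (q.snd_mem_support_of_mem_edges he)⟩
  have hmaximal := h.maximal
  rw [hT.isVine_eq] at hmaximal
  refine ⟨fun i => ?_, ?_⟩
  · obtain ⟨hx, hc⟩ := h.center i
    exact hT.eq_cball_of_maximal (hmaximal i) ((hT.mem_center_induce_iff (hmaximal i).prop).mp hc)
  have key : ∃ a b, T.IsSpine (k - 1) a b ∧ T.dist a (x 0) = k - 1 ∧
      T.dist (x 0) b + (k - 1) = T.dist a b ∧ T.dist b (x 1) = k - 1 ∧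
      T.dist (x 1) a + (k - 1) = T.dist b a := by
    obtain ⟨a, b, hmax⟩ := hT.exists_dist_max
    obtain ⟨c, d, hcd⟩ := hd
    have hlong : 2 * (k - 1) + 3 ≤ T.dist a b := by
      have := hmax c d
      omega
    have hspine : T.IsSpine (k - 1) a b := ⟨hT, by omega, hS, hmax, hlong⟩
    obtain ⟨p, hp, -⟩ := hT.connected.exists_path_of_dist a b
    have e := T.dist_comm (u := a) (v := b)
    obtain ⟨h1, h2⟩ := hT.dist_getVert hp (i := k - 1) (by omega)
    obtain ⟨h3, h4⟩ := hT.dist_getVert hp.reverse (i := k - 1) (by omega)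
    rcases h.ends a b p ((hT.isLongestPath_iff hp).mpr hmax) with ⟨h5, h6⟩ | ⟨h5, h6⟩
    · exact ⟨a, b, hspine, by rw [h5, h1], by rw [h5, h2], by rw [h6, h3], by rw [h6, h4]⟩
    · exact ⟨b, a, hspine.symm, by rw [h6, h3], by rw [h6, h4], by rw [h5, h1], by rw [h5, h2]⟩
  obtain ⟨a, b, hspine, h1, h2, h3, h4⟩ := key
  obtain ⟨o₀, ho₀⟩ := hspine.exists_isEnd h1 h2 h3 h4 (htr 0).1 (htr 0).2
  obtain ⟨o₁, ho₁⟩ := hspine.symm.exists_isEnd h3 h4 h1 h2 (htr 1).1 (htr 1).2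
  refine ⟨![o₀, o₁], Fin.forall_fin_two.mpr ⟨⟨a, b, ho₀⟩, ⟨b, a, ho₁⟩⟩, fun p hp => ?_⟩
  rcases hp.eq_or_eq ho₀ ho₁ with h | h
  exacts [⟨0, h⟩, ⟨1, h⟩]

end EndVines

/-! ### Matching the two ends -/

section Matching

variable {V V' : Type*} {T : SimpleGraph V} {T' : SimpleGraph V'} {j : ℕ}

/-- A bipartite graph on two plus two vertices without isolated vertices has a perfect matching, so
multiplicities of types are not needed. -/
lemma exists_perm_fin_two {r : Fin 2 → Fin 2 → Prop} (h : ∀ i, ∃ l, r i l) (h' : ∀ l, ∃ i, r i l) :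
    ∃ σ : Equiv.Perm (Fin 2), ∀ i, r i (σ i) := by
  simp only [Fin.forall_fin_two, Fin.exists_fin_two] at h h'
  by_cases h0 : r 0 0 ∧ r 1 1
  · exact ⟨Equiv.refl _, Fin.forall_fin_two.mpr h0⟩
  · exact ⟨Equiv.swap 0 1, Fin.forall_fin_two.mpr (by simp; tauto)⟩

/-- An isomorphism that respects the outward edges also respects the trunk edges. -/
lemma IsEnd.exists_iso {a b x o t : V} {a' b' x' o' t' : V'} (h : T.IsEnd j a b x o t)
    (h' : T'.IsEnd j a' b' x' o' t') (hr : RootedIso T T' j (x, o) (x', o')) :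
    ∃ φ : T.induce (T.cball x j) ≃g T'.induce (T'.cball x' j),
      (∀ u : ↥(T.cball x j), (u : V) = x ↔ (φ u : V') = x') ∧
      (∀ u : ↥(T.cball x j), (u : V) = t ↔ (φ u : V') = t') ∧
      (∀ u : ↥(T.cball x j), (u : V) ∈ {w | T.dist x w ≤ j ∧ T.dist t w + 1 = T.dist x w} ↔
        (φ u : V') ∈ {w | T'.dist x' w ≤ j ∧ T'.dist t' w + 1 = T'.dist x' w}) := by
  have hT := h.isSpine.isTree
  have hT' := h'.isSpine.isTree
  obtain ⟨φ, hm, h1, h2⟩ := hr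
  simp only at φ hm h1 h2
  have htmem : t ∈ T.cball x j := h.trunk_mem.1
  have hdist := hT.dist_iso hT' φ (hT.geodConvex_cball x j)
  have ht : (φ ⟨t, htmem⟩ : V') = t' := by
    have hadj : T'.Adj x' (φ ⟨t, htmem⟩) := by
      have : T'.Adj (φ ⟨x, self_mem_cball x j⟩ : V') (φ ⟨t, htmem⟩) :=
        (φ.map_adj_iff (v := ⟨x, self_mem_cball x j⟩) (w := ⟨t, htmem⟩)).mpr h.adj_trunk
      rwa [h1] at this
    have hs : ∃ s, T'.dist x' s = j ∧ T'.dist (φ ⟨t, htmem⟩ : V') s + 1 = j := by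
      obtain ⟨s, hs, hs'⟩ := h.exists_dist_trunk
      have e1 := hdist ⟨x, self_mem_cball x j⟩ ⟨s, mem_cball.mpr hs.le⟩
      have e2 := hdist ⟨t, htmem⟩ ⟨s, mem_cball.mpr hs.le⟩
      rw [h1] at e1
      exact ⟨_, e1.trans hs, by rw [e2, hs']⟩
    -- The image of `t` is a major direction at `x'`; it cannot be `o'`, which is already the image
    -- of `o`.
    refine (h'.eq_or_eq hadj hs).resolve_left fun he => h.out_ne_trunk ?_
    exact (congrArg Subtype.val (φ.injective (Subtype.ext (he.trans h2.symm)))).symm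
  have hiff : ∀ (v : V) (hv : v ∈ T.cball x j) (v' : V') (_ : (φ ⟨v, hv⟩ : V') = v')
      (u : ↥(T.cball x j)), (u : V) = v ↔ (φ u : V') = v' := by
    rintro v hv _ rfl u
    exact ⟨fun he => congrArg (fun z => (φ z : V')) (Subtype.ext he),
      fun he => congrArg Subtype.val (φ.injective (Subtype.ext he))⟩
  refine ⟨φ, hiff x _ x' h1, hiff t htmem t' ht, fun u => ?_⟩
  have e1 := hdist ⟨x, self_mem_cball x j⟩ u
  have e2 := hdist ⟨t, htmem⟩ u
  rw [h1] at e1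
  rw [ht] at e2
  rw [Set.mem_ofPred_eq, Set.mem_ofPred_eq, e1, e2]

end Matching

end SimpleGraph

open SimpleGraph in
theorem mainTheorem7 {V V' : Type*} [Finite V] [Finite V']
    (T : SimpleGraph V) (T' : SimpleGraph V') (hT : T.IsTree) (hT' : T'.IsTree)
    (n ℓ k : ℕ) (hV : Nat.card V = n) (hV' : Nat.card V' = n)
    (hdeck : deck T (n - ℓ) = deck T' (n - ℓ))
    (hk : IsVineLevel T ℓ k) (hS : ¬ ContainsThreeSpider T (k - 1)) :
    IsVineLevel T' ℓ k ∧ ¬ ContainsThreeSpider T' (k - 1) ∧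
    (∃ U x t, IsEndVines T k U x t) ∧ (∃ U' x' t', IsEndVines T' k U' x' t') ∧
    ∀ (U : Fin 2 → Set V) (x t : Fin 2 → V) (U' : Fin 2 → Set V') (x' t' : Fin 2 → V'),
      IsEndVines T k U x t → IsEndVines T' k U' x' t' →
      ∃ σ : Equiv.Perm (Fin 2), ∀ i : Fin 2,
        (majorPieces T (k - 1) (U i) (x i)).ncard = 2 ∧
        (majorPieces T' (k - 1) (U' (σ i)) (x' (σ i))).ncard = 2 ∧
        ∃ M ∈ majorPieces T (k - 1) (U i) (x i),
        ∃ M' ∈ majorPieces T' (k - 1) (U' (σ i)) (x' (σ i)),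
          t i ∈ M ∧ t' (σ i) ∈ M' ∧
          ∃ φ : T.induce (U i) ≃g T'.induce (U' (σ i)),
            (∀ u : ↥(U i), (u : V) = x i ↔ (φ u : V') = x' (σ i)) ∧
            (∀ u : ↥(U i), (u : V) = t i ↔ (φ u : V') = t' (σ i)) ∧
            (∀ u : ↥(U i), (u : V) ∈ M ↔ (φ u : V') ∈ M') := by
  subst hV
  have hlevel' := hT.isVineLevel_transfer hT' hV'.symm hdeck hk
  have hm : Nat.card V - ℓ ≤ Nat.card V := Nat.sub_le _ _
  have hm' : Nat.card V - ℓ ≤ Nat.card V' := hV' ▸ hm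
  have hlev : (∃ S, T.IsSubtree (2 * k + 1) S) ∧
      ∀ S, T.IsSubtree (2 * k + 1) S → S.ncard < Nat.card V - ℓ := by
    simpa only [IsEvine, hT.isSubtree_iff, Set.mem_ofPred_eq] using hk.1
  have hlev' := hT.isSubtree_transfer hT' hV'.symm hm hdeck hlev.1 hlev.2
  have hS' : ¬ ContainsThreeSpider T' (k - 1) := fun h =>
    hS (hT'.containsThreeSpider_transfer hV' hm' hdeck.symm (by omega) hlev'.1 hlev'.2 h)
  -- For `k ≤ 1` the legs have length `k - 1 = 0`, and the spider is a single vertex, which every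
  -- tree contains.
  have hk2 : 2 ≤ k := by
    by_contra! hlt
    obtain ⟨v⟩ := hT.connected.nonempty
    have h0 : k - 1 = 0 := by omega
    rw [h0] at hS
    exact hS (hT.containsThreeSpider_of_dist (c := v) (p := fun _ => v) (by simp) (by simp))
  have hd : ∃ a b, 2 * k + 1 ≤ T.dist a b := by
    obtain ⟨S, hS⟩ := hlev.1
    obtain ⟨a, -, b, -, hab⟩ := hS.exists_eq
    exact ⟨a, b, hab.ge⟩
  have hd' : ∃ a b, 2 * k + 1 ≤ T'.dist a b := by
    obtain ⟨S, hS⟩ := hlev'.1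
    obtain ⟨a, -, b, -, hab⟩ := hS.exists_eq
    exact ⟨a, b, hab.ge⟩
  -- Subtrees of smaller diameter extend to `k`-evines, so they too have fewer than `n - ℓ`
  -- vertices. The diameters needed are `2(k-1)` and `2(k-1)+1`.
  have hequiv : ∀ d, d ≤ 2 * k + 1 → MaximalEquiv T T' d := by
    intro d hle
    refine hT.exists_equiv_maximal hT' hV'.symm hm hdeck (fun S hS => ?_) fun S hS => ?_
    · obtain ⟨a, ha, -⟩ := hS.exists_eq
      exact (hT.ncard_lt_of_geodConvex hlev.1 hlev.2 hS.convex ⟨a, ha⟩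
        fun a ha b hb => (hS.le a ha b hb).trans hle).le
    · obtain ⟨a, ha, -⟩ := hS.exists_eq
      exact (hT'.ncard_lt_of_geodConvex hlev'.1 hlev'.2 hS.convex ⟨a, ha⟩
        fun a ha b hb => (hS.le a ha b hb).trans hle).le
  refine ⟨hlevel', hS', hT.exists_isEndVines hk2 hd hS, hT'.exists_isEndVines hk2 hd' hS', ?_⟩
  intro U x t U' x' t' h h'
  obtain ⟨hU, o, ho, hout⟩ := hT.isEndVines_spec hk2 hd hS h
  obtain ⟨hU', o', ho', hout'⟩ := hT'.isEndVines_spec hk2 hd' hS' h'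
  obtain rfl := funext hU
  obtain rfl := funext hU'
  have hv := hequiv (2 * (k - 1)) (by omega)
  have he := hequiv (2 * (k - 1) + 1) (by omega)
  obtain ⟨σ, hσ⟩ := exists_perm_fin_two
    (r := fun i l => RootedIso T T' (k - 1) (x i, o i) (x' l, o' l))
    (fun i => by
      obtain ⟨a, b, hab⟩ := ho i
      obtain ⟨p, hp, hrp⟩ := hT.exists_isOutward hT' (by omega) hv he hab.isOutward
      obtain ⟨l, rfl⟩ := hout' p hp
      exact ⟨l, hrp⟩)
    (fun l => by
      obtain ⟨a, b, hab⟩ := ho' l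
      obtain ⟨p, hp, hrp⟩ := hT'.exists_isOutward hT (by omega) hv.symm he.symm hab.isOutward
      obtain ⟨i, rfl⟩ := hout p hp
      exact ⟨i, hrp.symm⟩)
  refine ⟨σ, fun i => ?_⟩
  obtain ⟨a, b, hab⟩ := ho i
  obtain ⟨a', b', hab'⟩ := ho' (σ i)
  refine ⟨hab.ncard_majorPieces, hab'.ncard_majorPieces, _, ?_, _, ?_, hab.trunk_mem,
    hab'.trunk_mem, hab.exists_iso hab' (hσ i)⟩
  · rw [hab.majorPieces_eq]
    exact Or.inr rfl
  · rw [hab'.majorPieces_eq]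
    exact Or.inr rfl
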